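/- Let $k$ be a field, $q\in k$ (the value $q=0$ is allowed) and $n\ge 1$. Let $\mathcal H_n=\mathcal H_n(q)$ be the Hecke algebra of type $A_{n-1}$ over $k$, i.e. the unital associative $k$-algebra with generators $T_1,\dots,T_{n-1}$ and relations $T_iT_jT_i=T_jT_iT_j$ for $|i-j|=1$, $T_iT_j=T_jT_i$ for $|i-j|>1$, and $(T_i-q)(T_i+1)=0$ for all $i$. A parabolic subalgebra of $\mathcal H_n$ is a subalgebra generated by a subset of $\{T_1,\dots,T_{n-1}\}$. An indecomposable left $\mathcal H_n$-module has a $1$-dimensional source if it is isomorphic to a direct summand of $\mathcal H_n\otimes_{\mathcal H'}k(\chi)$ for some parabolic subalgebra $\mathcal H'$ and some algebra homomorphism $\chi:\mathcal H'\to k$, where $k(\chi)$ is the corresponding $1$-dimensional $\mathcal H'$-module. For subspaces $U_1,\dots,U_{n-1}$ of a $k$-vector space $M$ put $\Upsilon_i=\bigcap_{j<i}U_j$ and $\Sigma_i=\sum_{j>i}U_j$ for $0\le i\le n$ (so $\Upsilon_0=\Upsilon_1=M$ and $\Sigma_{n-1}=\Sigma_n=0$), and let $K_\bullet(M;(U_i))$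 be the complex $$0\to K_n\to K_{n-1}\to\cdots\to K_1\to K_0\to 0,\qquad K_i=\Upsilon_i/(\Upsilon_i\cap\Sigma_i),$$ whose differentials $K_i\to K_{i-1}$ are induced by the inclusions $\Upsilon_i\subset\Upsilon_{i-1}$ and $\Sigma_i\subset\Sigma_{i-1}$. Let $M$ be a finite-dimensional left $\mathcal H_n$-module whose indecomposable direct summands all have $1$-dimensional sources. Then the complex $K_\bullet(M;(U_i))$ is exact (at every term, including $K_n$ and $K_0$) in each of the following three cases: (a) $U_i=\operatorname{Ker}(T_i-q)_M$ for all $i$; (b) $U_i=\operatorname{Im}(T_i+1)_M$ for all $i$; (c) $U_i=\operatorname{Im}(T_i-q)_M=(T_i-q)M$ for all $i$. Here $x_M$ denotes the linear operator by which $x\in\mathcal H_n$ acts on $M$. -/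

import Mathlib

open scoped TensorProduct

namespace HeckeA

universe u v

/-! ### The Hecke algebra of type `A_{n-1}` -/

section Algebra

variable (k : Type u) [Field k] (q : k) (n : ℕ)

/-- The defining relations between the free generators indexed by `{i | 0 < i < n}`. Since the
braid and commutation relations are symmetric in `i, j`, they are only listed for `i < j`. -/
inductive Rel : FreeAlgebra k (Set.Ioo 0 n) → FreeAlgebra k (Set.Ioo 0 n) → Prop
  | braid (i j : Set.Ioo 0 n) (h : i.1 + 1 = j.1) :
      Rel (FreeAlgebra.ι k i * FreeAlgebra.ι k j * FreeAlgebra.ι k i)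
        (FreeAlgebra.ι k j * FreeAlgebra.ι k i * FreeAlgebra.ι k j)
  | comm (i j : Set.Ioo 0 n) (h : i.1 + 1 < j.1) :
      Rel (FreeAlgebra.ι k i * FreeAlgebra.ι k j) (FreeAlgebra.ι k j * FreeAlgebra.ι k i)
  | quad (i : Set.Ioo 0 n) :
      Rel ((FreeAlgebra.ι k i - algebraMap k _ q) * (FreeAlgebra.ι k i + 1)) 0

/-- The Hecke algebra `H_n(q)` of type `A_{n-1}` over `k`, by generators and relations. -/
def Hecke : Type u := RingQuot (Rel k q n)

noncomputable instance : Ring (Hecke k q n) := inferInstanceAs (Ring (RingQuot (Rel k q n)))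

noncomputable instance : Algebra k (Hecke k q n) :=
  inferInstanceAs (Algebra k (RingQuot (Rel k q n)))

variable {n}

/-- The generator `T_i`, `0 < i < n`. -/
noncomputable def T (i : Set.Ioo 0 n) : Hecke k q n :=
  RingQuot.mkAlgHom k (Rel k q n) (FreeAlgebra.ι k i)

/-- The parabolic subalgebra generated by the `T_i` with `i ∈ J`. The subsets `J` of
`{1, …, n - 1}` correspond bijectively to the compositions of `n`. -/
noncomputable def parabolic (J : Set (Set.Ioo 0 n)) : Subalgebra k (Hecke k q n) :=
  Algebra.adjoin k (T k q '' J)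

end Algebra

/-! ### Induction from one-dimensional representations, one-dimensional sources -/

section Sources

variable {k : Type u} [Field k] {A : Type u} [Ring A] [Algebra k A]

/-- The `B`-balancing relations `ab ⊗ c = a ⊗ χ(b)c` on `A ⊗[k] k`. -/
def balancing (B : Subalgebra k A) (χ : B →ₐ[k] k) : Submodule A (A ⊗[k] k) :=
  Submodule.span A
    {x | ∃ (a : A) (b : B) (c : k), x = (a * (b : A)) ⊗ₜ[k] c - a ⊗ₜ[k] (χ b * c)}

/-- The `A`-module `A ⊗_B k(χ)` induced from the one-dimensional representation `χ` of the
subalgebra `B`, as the quotient of `A ⊗_k k` by the `B`-balancing relations. -/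
abbrev Induced (B : Subalgebra k A) (χ : B →ₐ[k] k) : Type u :=
  (A ⊗[k] k) ⧸ balancing B χ

end Sources

/-- A module is indecomposable if it is nonzero and is not the direct sum of two nonzero
submodules. -/
def Indecomposable (A : Type u) [Ring A] (N : Type v) [AddCommGroup N] [Module A N] : Prop :=
  Nontrivial N ∧ ∀ P Q : Submodule A N, IsCompl P Q → P = ⊥ ∨ Q = ⊥

/-- `N` is isomorphic to a direct summand of an `H_n(q)`-module induced from a one-dimensional
representation of a parabolic subalgebra. -/
def HasOneDimSource (k : Type u) [Field k] (q : k) (n : ℕ)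
    (N : Type v) [AddCommGroup N] [Module (Hecke k q n) N] : Prop :=
  ∃ (J : Set (Set.Ioo 0 n)) (χ : parabolic k q J →ₐ[k] k)
    (P Q : Submodule (Hecke k q n) (Induced (parabolic k q J) χ)),
    IsCompl P Q ∧ Nonempty (N ≃ₗ[Hecke k q n] P)

/-- All indecomposable direct summands of `M` have one-dimensional sources. -/
def SummandsHaveOneDimSources (k : Type u) [Field k] (q : k) (n : ℕ)
    (M : Type v) [AddCommGroup M] [Module (Hecke k q n) M] : Prop :=
  ∀ N N' : Submodule (Hecke k q n) M, IsCompl N N' →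
    Indecomposable (Hecke k q n) N → HasOneDimSource k q n N

/-! ### The complex attached to a sequence of subspaces -/

section Complex

variable {k : Type u} [Field k] {M : Type v} [AddCommGroup M] [Module k M] {n : ℕ}
  (U : Set.Ioo 0 n → Submodule k M)

/-- The intersection of the `U_j` with `j < i` (all of `M` if `i ≤ 1`). -/
def Upsilon (i : ℕ) : Submodule k M := ⨅ (j : Set.Ioo 0 n) (_ : j.1 < i), U j

/-- The sum of the `U_j` with `j > i` (zero if `i ≥ n - 1`). -/
def Sigma' (i : ℕ) : Submodule k M := ⨆ (j : Set.Ioo 0 n) (_ : i < j.1), U j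

theorem upsilon_succ_le (i : ℕ) : Upsilon U (i + 1) ≤ Upsilon U i :=
  le_iInf₂ fun j hj => iInf₂_le j (Nat.lt_succ_of_lt hj)

theorem sigma_succ_le (i : ℕ) : Sigma' U (i + 1) ≤ Sigma' U i :=
  iSup₂_le fun j hj => le_iSup₂_of_le j (Nat.lt_of_succ_lt hj) le_rfl

/-- The term `K_i = Υ_i / (Υ_i ∩ Σ_i)` of the complex, `0 ≤ i ≤ n`. -/
abbrev K (i : ℕ) : Type v := Upsilon U i ⧸ (Sigma' U i).submoduleOf (Upsilon U i)

/-- The differential `∂_{i+1} : K_{i+1} → K_i` induced by inclusion, `0 ≤ i < n`. -/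
def d (i : ℕ) : K U (i + 1) →ₗ[k] K U i :=
  Submodule.mapQ _ _ (Submodule.inclusion (upsilon_succ_le U i))
    (fun _ hx => sigma_succ_le U i hx)

/-- Exactness of `0 → K_n → … → K_1 → K_0 → 0` (for `n ≥ 1`) at all its terms. -/
structure KExact : Prop where
  /-- exactness at `K_0` -/
  surjective : Function.Surjective (d U 0)
  /-- exactness at `K_{i+1}` for `0 < i + 1 < n` -/
  exact : ∀ i : ℕ, i + 1 < n → Function.Exact (d U (i + 1)) (d U i)
  /-- exactness at `K_n` -/
  injective : ∀ i : ℕ, i + 1 = n → Function.Injective (d U i)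

end Complex

/-! ### The operators by which elements of the Hecke algebra act -/

/-- The `k`-linear operator `x_M` by which `x` acts on `M`. -/
noncomputable def op {k : Type u} [Field k] {q : k} {n : ℕ} (M : Type v) [AddCommGroup M] [Module k M]
    [Module (Hecke k q n) M] [IsScalarTower k (Hecke k q n) M] (x : Hecke k q n) :
    M →ₗ[k] M where
  toFun m := x • m
  map_add' := smul_add x
  map_smul' c m := by
    rw [RingHom.id_apply, ← algebraMap_smul (Hecke k q n) c m, smul_smul,
      ← Algebra.commutes, mul_smul, algebraMap_smul]

end HeckeA

/-!
Exactness of `K_•` at `K_i`, `0 < i < n`, says that `Υ_i ∩ Σ_{i-1} ⊆ Υ_{i+1} + Υ_i ∩ Σ_i`;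
exactness at the two ends is automatic.

This holds whenever `U_i = Ker P_i` for idempotent operators `P_i` satisfying the braid relations,
that is, for an action of the `0`-Hecke algebra (`IsZeroHecke.splits`). The longest elements of
parabolic subgroups provide a projection `A` onto `Υ_i` and a commuting projection `B` with kernel
`Σ_i`, so that `e = A * B` is an idempotent with image isomorphic to `K_i`. The longest elements
that project onto `Υ_{i+1}` and along `Σ_{i-1}` are `A * (1 - P_i) * A` and `B * P_i * B`, and the
identity `e * (A * (1 - P_i) * A + B * P_i * B) * e = e` is a contracting homotopy.

For `q = 0` the operators `-T_i` and `1 + T_i` are of this kind on every module, and their kernels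
are the subspaces in question. For `q ≠ 0` a one-dimensional representation of a parabolic
subalgebra takes a single value, `q` or `-1`, on each block of generators, and the module induced
from it is a direct summand of a space with basis the words in an alphabet of two kinds of letters
(`exists_retract_induced`); this is the super analogue of the action of the Hecke algebra on tensor
powers. On words the three families of subspaces are the kernels of the rewriting rules
`ba ↦ β ab` for `a < b` and `aa ↦ 0` for some of the letters `a`. These rules are idempotent and
confluent, and confluence is the braid relation (`rewriteOp_braid`). In other words, the quadratic
algebras defined by the relations `U` have a basis of ordered monomials, which is why they are
Koszul. The condition passes to direct summands and to finite direct sums, hence to `M`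
(`splits_of_summands`).
-/

open scoped TensorProduct

namespace HeckeA

/-! ### Exactness as a modularity condition -/

section Exactness

variable {k : Type*} [Field k] {M N : Type*} [AddCommGroup M] [Module k M] [AddCommGroup N]
  [Module k N] {n : ℕ}

theorem mem_upsilon {U : Set.Ioo 0 n → Submodule k M} {i : ℕ} {m : M} :
    m ∈ Upsilon U i ↔ ∀ j : Set.Ioo 0 n, j.1 < i → m ∈ U j := by
  simp [Upsilon]

theorem le_sigma (U : Set.Ioo 0 n → Submodule k M) {i : ℕ} (j : Set.Ioo 0 n) (h : i < j.1) :
    U j ≤ Sigma' U i :=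
  le_iSup₂_of_le j h le_rfl

theorem sigma_eq_bot (U : Set.Ioo 0 n → Submodule k M) {i : ℕ} (h : n ≤ i + 1) :
    Sigma' U i = ⊥ := by
  rw [Sigma', eq_bot_iff]
  refine iSup₂_le fun j hj => ?_
  have := j.2.2
  omega

theorem sigma_eq_sup (U : Set.Ioo 0 n → Submodule k M) {i : ℕ} (j : Set.Ioo 0 n)
    (h : i + 1 = j.1) : Sigma' U i = U j ⊔ Sigma' U (i + 1) := by
  apply le_antisymm
  · refine iSup₂_le fun l hl => ?_
    rcases eq_or_ne l j with rfl | hne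
    · exact le_sup_left
    · have : l.1 ≠ j.1 := fun e => hne (Subtype.ext e)
      exact (le_sigma U l (by omega)).trans le_sup_right
  · exact sup_le (le_sigma U j (by omega)) (sigma_succ_le U i)

/-- The endomorphism `f` splits every element of `Υ_{i+1} ∩ Σ_i` into an element of `Υ_{i+2}` and
an element of `Υ_{i+1} ∩ Σ_{i+1}`. For `f = id` this is the exactness of the complex of `U`; the
version with `f` is additive in `f`, which makes it convenient for direct sum decompositions. -/
def Splits (U : Set.Ioo 0 n → Submodule k M) (f : M →ₗ[k] M) : Prop :=
  ∀ i, i + 1 < n → ∀ m ∈ Upsilon U (i + 1), m ∈ Sigma' U i →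
    f m ∈ Upsilon U (i + 2) ⊔ (Upsilon U (i + 1) ⊓ Sigma' U (i + 1))

theorem Splits.add {U : Set.Ioo 0 n → Submodule k M} {f g : M →ₗ[k] M} (hf : Splits U f)
    (hg : Splits U g) : Splits U (f + g) :=
  fun i hi m hm hm' => add_mem (hf i hi m hm hm') (hg i hi m hm hm')

theorem splits_zero (U : Set.Ioo 0 n → Submodule k M) : Splits U (0 : M →ₗ[k] M) :=
  fun _ _ _ _ _ => zero_mem _

theorem upsilon_le_comap {U : Set.Ioo 0 n → Submodule k M} {V : Set.Ioo 0 n → Submodule k N}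
    {f : M →ₗ[k] N} (hf : ∀ i, U i ≤ (V i).comap f) (i : ℕ) :
    Upsilon U i ≤ (Upsilon V i).comap f :=
  fun _ hm => mem_upsilon.2 fun j hj => hf j (mem_upsilon.1 hm j hj)

theorem sigma_le_comap {U : Set.Ioo 0 n → Submodule k M} {V : Set.Ioo 0 n → Submodule k N}
    {f : M →ₗ[k] N} (hf : ∀ i, U i ≤ (V i).comap f) (i : ℕ) :
    Sigma' U i ≤ (Sigma' V i).comap f :=
  iSup₂_le fun j hj => (hf j).trans (Submodule.comap_mono (le_sigma V j hj))

/-- An endomorphism that factors through a space with an exact complex splits. -/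
theorem Splits.of_factor {U : Set.Ioo 0 n → Submodule k M} {V : Set.Ioo 0 n → Submodule k N}
    (hV : Splits V LinearMap.id) {f : M →ₗ[k] N} {g : N →ₗ[k] M}
    (hf : ∀ i, U i ≤ (V i).comap f) (hg : ∀ i, V i ≤ (U i).comap g) : Splits U (g ∘ₗ f) := by
  intro i hi m hm hm'
  have h := hV i hi (f m) (upsilon_le_comap hf _ hm) (sigma_le_comap hf _ hm')
  obtain ⟨a, ha, b, hb, hab⟩ := Submodule.mem_sup.1 h
  rw [LinearMap.id_apply] at hab
  rw [LinearMap.comp_apply, ← hab, map_add]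
  exact Submodule.add_mem_sup (upsilon_le_comap hg _ ha)
    ⟨upsilon_le_comap hg _ hb.1, sigma_le_comap hg _ hb.2⟩

theorem d_mk {U : Set.Ioo 0 n → Submodule k M} {i : ℕ} {y : M} (hy : y ∈ Upsilon U (i + 1)) :
    d U i (Submodule.Quotient.mk ⟨y, hy⟩) =
      Submodule.Quotient.mk ⟨y, upsilon_succ_le U i hy⟩ :=
  rfl

theorem d_mk_eq_zero_iff {U : Set.Ioo 0 n → Submodule k M} {i : ℕ} {y : M}
    (hy : y ∈ Upsilon U (i + 1)) :
    d U i (Submodule.Quotient.mk ⟨y, hy⟩) = 0 ↔ y ∈ Sigma' U i := by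
  rw [d_mk, Submodule.Quotient.mk_eq_zero]
  rfl

theorem Splits.kExact {U : Set.Ioo 0 n → Submodule k M} (h : Splits U LinearMap.id) :
    KExact U where
  surjective := by
    intro y
    obtain ⟨⟨y, hy⟩, rfl⟩ := Submodule.Quotient.mk_surjective _ y
    refine ⟨Submodule.Quotient.mk ⟨y, mem_upsilon.2 fun j hj => ?_⟩, rfl⟩
    have := j.2.1
    omega
  exact := by
    intro i hi y
    obtain ⟨⟨y, hy⟩, rfl⟩ := Submodule.Quotient.mk_surjective _ y
    constructor
    · intro hy0
      have hyS : y ∈ Sigma' U i := (d_mk_eq_zero_iff hy).1 hy0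
      obtain ⟨a, ha, b, hb, hab⟩ := Submodule.mem_sup.1 (h i hi y hy hyS)
      refine ⟨Submodule.Quotient.mk ⟨a, ha⟩, (Submodule.Quotient.eq _).2 ?_⟩
      change a - y ∈ Sigma' U (i + 1)
      rw [← show a + b = y from hab, sub_add_cancel_left]
      exact neg_mem hb.2
    · rintro ⟨z, hz⟩
      obtain ⟨⟨z, hz'⟩, rfl⟩ := Submodule.Quotient.mk_surjective _ z
      have h1 : z - y ∈ Sigma' U (i + 1) := by
        rw [d_mk, Submodule.Quotient.eq] at hz
        exact hz
      refine (d_mk_eq_zero_iff hy).2 ?_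
      have h2 : z ∈ Sigma' U i :=
        le_sigma U ⟨i + 1, by omega, hi⟩ (Nat.lt_succ_self i)
          (mem_upsilon.1 hz' ⟨i + 1, by omega, hi⟩ (Nat.lt_succ_self _))
      simpa using sub_mem h2 (sigma_succ_le U i h1)
  injective := by
    intro i hi
    rw [injective_iff_map_eq_zero]
    intro y hy0
    obtain ⟨⟨y, hy⟩, rfl⟩ := Submodule.Quotient.mk_surjective _ y
    have hyS : y ∈ Sigma' U i := (d_mk_eq_zero_iff hy).1 hy0
    rw [sigma_eq_bot U (by omega), Submodule.mem_bot] at hyS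
    subst hyS
    exact (Submodule.Quotient.mk_eq_zero _).2 (zero_mem _)

end Exactness

/-! ### Kernels of idempotents satisfying the braid relations -/

section ZeroHecke

variable {k : Type*} [Field k] {M : Type*} [AddCommGroup M] [Module k M] {n : ℕ}

/-- Idempotent operators satisfying the braid relations, i.e. an action of the `0`-Hecke algebra of
type `A_{n-1}`. -/
structure IsZeroHecke (P : Set.Ioo 0 n → Module.End k M) : Prop where
  idem : ∀ i, P i * P i = P i
  braid : ∀ i j : Set.Ioo 0 n, i.1 + 1 = j.1 → P i * P j * P i = P j * P i * P j
  comm : ∀ i j : Set.Ioo 0 n, i.1 + 1 < j.1 → P i * P j = P j * P i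

theorem IsZeroHecke.commute {P : Set.Ioo 0 n → Module.End k M} (hP : IsZeroHecke P)
    {i j : Set.Ioo 0 n} (h : i.1 + 1 < j.1) : Commute (P i) (P j) :=
  hP.comm i j h

theorem IsZeroHecke.one_sub {P : Set.Ioo 0 n → Module.End k M} (hP : IsZeroHecke P) :
    IsZeroHecke fun i => 1 - P i where
  idem i := (IsIdempotentElem.one_sub (hP.idem i))
  braid i j h := by
    have hi := hP.idem i
    have hj := hP.idem j
    have hb := hP.braid i j h
    have e1 : (1 - P i) * (1 - P j) * (1 - P i)
        = 1 - P i - P j + P i * P j + P j * P i - P i * P j * P i + (P i * P i - P i) := by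
      noncomm_ring
    have e2 : (1 - P j) * (1 - P i) * (1 - P j)
        = 1 - P i - P j + P i * P j + P j * P i - P j * P i * P j + (P j * P j - P j) := by
      noncomm_ring
    rw [e1, e2, hi, hj, hb, sub_self, sub_self]
  comm i j h := ((Commute.one_left _).sub_left ((Commute.one_right _).sub_right (hP.commute h)))

/-- There is a projection `A` onto `Υ_i`. It is the element of the `0`-Hecke algebra, written in the
idempotents `1 - P j`, that belongs to the longest element of the parabolic subgroup generated by
the `s_j`, `j < i`; the last property says that `A * (1 - P i) * A` is the next such
element. -/
theorem IsZeroHecke.exists_proj_upsilon {P : Set.Ioo 0 n → Module.End k M} (hP : IsZeroHecke P)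
    (i : ℕ) :
    ∃ A : Module.End k M, (∀ m ∈ Upsilon (fun j => LinearMap.ker (P j)) i, A m = m) ∧
      (∀ m, A m ∈ Upsilon (fun j => LinearMap.ker (P j)) i) ∧
      (∀ C : Module.End k M, (∀ j : Set.Ioo 0 n, j.1 < i → Commute C (P j)) → Commute C A) ∧
      ∀ j : Set.Ioo 0 n, j.1 = i → P j * (A * (1 - P j) * A) = 0 := by
  induction i with
  | zero =>
    refine ⟨1, fun _ _ => rfl, fun m => mem_upsilon.2 fun j hj => absurd hj (by omega),
      fun C _ => Commute.one_right C, fun j hj => ?_⟩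
    have := j.2.1
    omega
  | succ i ih =>
    obtain ⟨A, h1, h2, h3, h4⟩ := ih
    have hAA : A * A = A := LinearMap.ext fun m => h1 _ (h2 m)
    by_cases hi : i ∈ Set.Ioo 0 n
    · set s : Set.Ioo 0 n := ⟨i, hi⟩ with hs
      have h4 := h4 s rfl
      have hcomm : ∀ C : Module.End k M, (∀ j : Set.Ioo 0 n, j.1 < i + 1 → Commute C (P j)) →
          Commute C (A * (1 - P s) * A) := fun C hC => by
        have hA := h3 C fun j hj => hC j (by omega)
        exact (hA.mul_right ((Commute.one_right C).sub_right (hC s (Nat.lt_succ_self i)))).mul_right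
          hA
      refine ⟨A * (1 - P s) * A, fun m hm => ?_, fun m => ?_, hcomm, fun t ht => ?_⟩
      · have hAm := h1 m (upsilon_succ_le _ i hm)
        have hs : P s m = 0 := mem_upsilon.1 hm s (Nat.lt_succ_self i)
        simp [Module.End.mul_apply, hAm, hs]
      · refine mem_upsilon.2 fun j hj => ?_
        rcases eq_or_ne j s with rfl | hne
        · exact LinearMap.congr_fun h4 m
        · have : j.1 ≠ i := fun e => hne (Subtype.ext e)
          exact mem_upsilon.1 (h2 _) j (by omega)
      · -- `s` and `t` are consecutive, and `P t` commutes with `A`.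
        have hst : s.1 + 1 = t.1 := ht.symm
        have hAt : P t * A = A * P t := h3 (P t) fun j hj =>
          (hP.commute (by omega)).symm
        have hb := hP.one_sub.braid s t hst
        have hQs : A * (1 - P s) * A = (1 - P s) * (A * (1 - P s) * A) := by
          rw [sub_mul 1 (P s), h4, one_mul, sub_zero]
        have hPQ : P t * (1 - P t) = 0 := by rw [mul_sub, mul_one, hP.idem, sub_self]
        have hAQ : A * (1 - P t) = (1 - P t) * A := by
          rw [mul_sub, sub_mul, mul_one, one_mul, hAt]
        calc P t * (A * (1 - P s) * A * (1 - P t) * (A * (1 - P s) * A))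
            = (P t * A) * (1 - P s) * (A * (1 - P t)) * (A * (1 - P s) * A) := by
              noncomm_ring
          _ = A * P t * (1 - P s) * (1 - P t) * ((A * A) * (1 - P s) * A) := by
              rw [hAt, hAQ]; simp only [mul_assoc]
          _ = A * P t * ((1 - P s) * (1 - P t) * (1 - P s)) * (A * (1 - P s) * A) := by
              rw [hAA]; nth_rewrite 1 [hQs]; simp only [mul_assoc]
          _ = A * (P t * (1 - P t)) * ((1 - P s) * (1 - P t)) * (A * (1 - P s) * A) := by
              rw [hb]; simp only [mul_assoc]
          _ = 0 := by rw [hPQ]; simp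
    · refine ⟨A, fun m hm => h1 m (upsilon_succ_le _ i hm), fun m => mem_upsilon.2 fun j hj => ?_,
        fun C hC => h3 C fun j hj => hC j (by omega), fun j hj => ?_⟩
      · have hne : j.1 ≠ i := fun e => hi (e ▸ j.2)
        exact mem_upsilon.1 (h2 m) j (by omega)
      · -- `i ∉ (0, n)` and `i + 1 ∈ (0, n)` force `i = 0`, and then `A` commutes with everything.
        have hj1 := j.2.2
        have hi0 : i = 0 := by
          by_contra h0
          exact hi ⟨by omega, by omega⟩
        have hc : Commute (P j) A := h3 (P j) fun l hl => absurd hl (by omega)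
        have hc' : A * (1 - P j) = (1 - P j) * A := by
          rw [mul_sub, sub_mul, mul_one, one_mul, hc.eq]
        rw [hc', ← mul_assoc, ← mul_assoc, mul_sub, mul_one, hP.idem, sub_self, zero_mul, zero_mul]

/-- There is a projection `B` with kernel `Σ_i`: the element of the `0`-Hecke algebra belonging to
the longest element of the parabolic subgroup generated by the `s_j`, `j > i`. The last property
says that `B * P i * B` is the next such element. -/
theorem IsZeroHecke.exists_proj_sigma {P : Set.Ioo 0 n → Module.End k M} (hP : IsZeroHecke P)
    (i d : ℕ) (hid : i + d + 1 = n) :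
    ∃ B : Module.End k M, (∀ m, m - B m ∈ Sigma' (fun j => LinearMap.ker (P j)) i) ∧
      (∀ m ∈ Sigma' (fun j => LinearMap.ker (P j)) i, B m = 0) ∧
      (∀ C : Module.End k M, (∀ j : Set.Ioo 0 n, i < j.1 → Commute C (P j)) → Commute C B) ∧
      ∀ j : Set.Ioo 0 n, j.1 = i → (B * P j * B) * (1 - P j) = 0 := by
  have hPQ : ∀ j, P j * (1 - P j) = 0 := fun j => by rw [mul_sub, mul_one, hP.idem, sub_self]
  induction d generalizing i with
  | zero =>
    refine ⟨1, fun m => by simp, fun m hm => ?_, fun C _ => Commute.one_right C, fun j _ => ?_⟩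
    · rw [sigma_eq_bot _ (by omega), Submodule.mem_bot] at hm
      simp [hm]
    · simp [hPQ]
  | succ d ih =>
    obtain ⟨B, h1, h2, h3, h4⟩ := ih (i + 1) (by omega)
    have hBB : B * B = B := LinearMap.ext fun m => by
      have := h2 _ (h1 m)
      rw [map_sub, sub_eq_zero] at this
      exact this.symm
    set t : Set.Ioo 0 n := ⟨i + 1, by omega, by omega⟩ with ht
    have h4 := h4 t rfl
    refine ⟨B * P t * B, fun m => ?_, fun m hm => ?_, fun C hC => ?_, fun s hs => ?_⟩
    · have e : m - (B * P t * B) m = (m - B m) + (B m - P t (B m)) +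
          (P t (B m) - B (P t (B m))) := by
        simp [Module.End.mul_apply]
      rw [e]
      refine add_mem (add_mem (sigma_succ_le _ _ (h1 m)) ?_) (sigma_succ_le _ _ (h1 _))
      refine le_sigma _ t (Nat.lt_succ_self i) ?_
      rw [LinearMap.mem_ker, map_sub, ← Module.End.mul_apply (P t) (P t), hP.idem, sub_self]
    · rw [sigma_eq_sup _ t rfl] at hm
      obtain ⟨a, ha, b, hb, rfl⟩ := Submodule.mem_sup.1 hm
      have ha' : P t a = 0 := ha
      have : (B * P t * B) ((1 - P t) a) = 0 := LinearMap.congr_fun h4 a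
      have hb' := h2 b hb
      simp only [LinearMap.sub_apply, Module.End.one_apply, ha', sub_zero] at this
      rw [map_add, this, zero_add, Module.End.mul_apply, hb', map_zero]
    · have hB := h3 C fun j hj => hC j (by omega)
      exact (hB.mul_right (hC t (Nat.lt_succ_self i))).mul_right hB
    · have hst : s.1 + 1 = t.1 := by simp [ht, hs]
      have hBs : P s * B = B * P s := h3 (P s) fun j hj => hP.commute (by omega)
      have hb := hP.braid s t hst
      have hQt : B * P t * B = (B * P t * B) * P t := by
        rw [mul_sub, mul_one, sub_eq_zero] at h4
        exact h4
      have hBQ : B * (1 - P s) = (1 - P s) * B := by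
        rw [mul_sub, sub_mul, mul_one, one_mul, hBs]
      calc (B * P t * B) * P s * (B * P t * B) * (1 - P s)
          = B * P t * B * (P s * B) * P t * (B * (1 - P s)) := by noncomm_ring
        _ = B * P t * (B * B) * P s * P t * (1 - P s) * B := by
            rw [hBs, hBQ]; simp only [mul_assoc]
        _ = (B * P t * B) * (P t * P s * P t) * (1 - P s) * B := by
            rw [hBB]; nth_rewrite 1 [hQt]; simp only [mul_assoc]
        _ = (B * P t * B) * (P s * P t) * (P s * (1 - P s)) * B := by
            rw [← hb]; simp only [mul_assoc]
        _ = 0 := by rw [hPQ]; simp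

/-- The complex of the kernels is exact for every module over the `0`-Hecke algebra. With
`e = A * B` the identity `e * (A * (1 - P i) * A + B * P i * B) * e = e` is a contracting
homotopy. -/
theorem IsZeroHecke.splits {P : Set.Ioo 0 n → Module.End k M} (hP : IsZeroHecke P) :
    Splits (fun j => LinearMap.ker (P j)) LinearMap.id := by
  intro i hi m hm hm'
  obtain ⟨A, a1, a2, a3, a4⟩ := hP.exists_proj_upsilon (i + 1)
  obtain ⟨B, b1, b2, b3, b4⟩ := hP.exists_proj_sigma (i + 1) (n - i - 2) (by omega)
  set s : Set.Ioo 0 n := ⟨i + 1, by omega, hi⟩ with hs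
  have a4 := a4 s rfl
  have b4 := b4 s rfl
  have hAB : ∀ x, A (B x) = B (A x) := by
    have : Commute A B := b3 A fun j hj => (a3 (P j) fun l hl => (hP.commute (by omega)).symm).symm
    exact fun x => LinearMap.congr_fun this.eq x
  have hBm : B (P s (B m)) = 0 := by
    rw [sigma_eq_sup _ s rfl] at hm'
    obtain ⟨a, ha, b, hb, rfl⟩ := Submodule.mem_sup.1 hm'
    have ha' : P s a = 0 := ha
    have h : (B * P s * B) ((1 - P s) a) = 0 := LinearMap.congr_fun b4 a
    simp only [LinearMap.sub_apply, Module.End.one_apply, ha', sub_zero] at h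
    rw [map_add, b2 b hb, add_zero]
    exact h
  have hBB : B (B m) = B m := by
    have := b2 _ (b1 m)
    rw [map_sub, sub_eq_zero] at this
    exact this.symm
  have hAy : A (B m) = B m := by rw [hAB, a1 m hm]
  have hy : B m ∈ Upsilon (fun j => LinearMap.ker (P j)) (i + 1) := hAy ▸ a2 (B m)
  set z : M := A ((1 - P s) (A (B m))) with hz
  have hzU : z ∈ Upsilon (fun j => LinearMap.ker (P j)) (i + 2) := by
    refine mem_upsilon.2 fun j hj => ?_
    rcases eq_or_ne j s with rfl | hne
    · exact LinearMap.congr_fun a4 (B m)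
    · have : j.1 ≠ i + 1 := fun e => hne (Subtype.ext e)
      exact mem_upsilon.1 (a2 _) j (by omega)
  have hBz : B z = B m := by
    rw [hz, hAy, ← hAB, LinearMap.sub_apply, Module.End.one_apply, map_sub, hBm, hBB, sub_zero, hAy]
  have e : m = z + ((m - B m) - (z - B z)) := by rw [hBz]; abel
  rw [LinearMap.id_apply, e]
  refine Submodule.add_mem_sup hzU ⟨sub_mem (sub_mem hm hy) (sub_mem ?_ (hBz ▸ hy)),
    sub_mem (b1 m) (b1 z)⟩
  exact upsilon_succ_le _ _ hzU

end ZeroHecke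

/-! ### Operators on words -/

section Words

variable {k : Type*} [Field k]

/-- The word obtained from `x` by exchanging the letters at the positions `i` and `i + 1`. -/
def exchange (i : ℕ) (x : ℕ → ℕ) : ℕ → ℕ := x ∘ Equiv.swap i (i + 1)

@[simp] theorem exchange_left (i : ℕ) (x : ℕ → ℕ) : exchange i x i = x (i + 1) := by
  simp [exchange]

@[simp] theorem exchange_right (i : ℕ) (x : ℕ → ℕ) : exchange i x (i + 1) = x i := by
  simp [exchange]

theorem exchange_of_ne (i : ℕ) (x : ℕ → ℕ) {j : ℕ} (h : j ≠ i) (h' : j ≠ i + 1) :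
    exchange i x j = x j := by
  simp [exchange, Equiv.swap_apply_of_ne_of_ne h h']

@[simp] theorem exchange_add_two (i : ℕ) (x : ℕ → ℕ) : exchange i x (i + 2) = x (i + 2) :=
  exchange_of_ne i x (by omega) (by omega)

@[simp] theorem exchange_succ_self (i : ℕ) (x : ℕ → ℕ) : exchange (i + 1) x i = x i :=
  exchange_of_ne _ x (by omega) (by omega)

@[simp] theorem exchange_exchange (i : ℕ) (x : ℕ → ℕ) : exchange i (exchange i x) = x := by
  ext j; simp [exchange]

theorem exchange_braid (i : ℕ) (x : ℕ → ℕ) :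
    exchange (i + 1) (exchange i (exchange (i + 1) x)) =
      exchange i (exchange (i + 1) (exchange i x)) := by
  ext j
  by_cases h0 : j = i
  · subst h0; simp
  by_cases h1 : j = i + 1
  · subst h1; simp
  by_cases h2 : j = i + 2
  · subst h2; simp
  have h3 : j ≠ i + 1 + 1 := h2
  simp [exchange_of_ne, h0, h1, h3]

theorem exchange_comm {i j : ℕ} (h : i + 1 < j) (x : ℕ → ℕ) :
    exchange i (exchange j x) = exchange j (exchange i x) := by
  ext l
  by_cases h0 : l = i
  · subst h0; simp [exchange_of_ne _ _ (show l ≠ j by omega) (show l ≠ j + 1 by omega),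
      exchange_of_ne _ _ (show l + 1 ≠ j by omega) (show l + 1 ≠ j + 1 by omega)]
  by_cases h1 : l = i + 1
  · subst h1; simp [exchange_of_ne _ _ (show i ≠ j by omega) (show i ≠ j + 1 by omega),
      exchange_of_ne _ _ (show i + 1 ≠ j by omega) (show i + 1 ≠ j + 1 by omega)]
  by_cases h2 : l = j
  · subst h2; simp [exchange_of_ne _ _ h0 h1,
      exchange_of_ne _ _ (show l + 1 ≠ i by omega) (show l + 1 ≠ i + 1 by omega)]
  by_cases h3 : l = j + 1
  · subst h3; simp [exchange_of_ne _ _ h0 h1,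
      exchange_of_ne _ _ (show j ≠ i by omega) (show j ≠ i + 1 by omega)]
  simp [exchange_of_ne, h0, h1, h2, h3]

/-- The operator on the space with basis the words in `ℕ` which acts at the positions `i` and
`i + 1`: by the matrix `A` on the span of a word `x` with `x i < x (i + 1)` and of `exchange i x`
(in this order), and by the scalar `c a` on a word with the letter `a` at both positions. -/
noncomputable def block (i : ℕ) (A : Matrix (Fin 2) (Fin 2) k) (c : ℕ → k) :
    Module.End k ((ℕ → ℕ) →₀ k) :=
  Finsupp.linearCombination k fun x =>
    if x i < x (i + 1) then
      A 0 0 • Finsupp.single x 1 + A 1 0 • Finsupp.single (exchange i x) 1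
    else if x (i + 1) < x i then
      A 0 1 • Finsupp.single (exchange i x) 1 + A 1 1 • Finsupp.single x 1
    else c (x i) • Finsupp.single x 1

theorem block_of_lt {i : ℕ} (A : Matrix (Fin 2) (Fin 2) k) (c : ℕ → k) {x : ℕ → ℕ}
    (h : x i < x (i + 1)) : block i A c (Finsupp.single x 1) =
      A 0 0 • Finsupp.single x 1 + A 1 0 • Finsupp.single (exchange i x) 1 := by
  simp only [block, Finsupp.linearCombination_single, one_smul, if_pos h]

theorem block_of_gt {i : ℕ} (A : Matrix (Fin 2) (Fin 2) k) (c : ℕ → k) {x : ℕ → ℕ}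
    (h : x (i + 1) < x i) : block i A c (Finsupp.single x 1) =
      A 0 1 • Finsupp.single (exchange i x) 1 + A 1 1 • Finsupp.single x 1 := by
  simp only [block, Finsupp.linearCombination_single, one_smul, if_pos h, if_neg h.not_gt]

theorem block_of_eq {i : ℕ} (A : Matrix (Fin 2) (Fin 2) k) (c : ℕ → k) {x : ℕ → ℕ}
    (h : x i = x (i + 1)) : block i A c (Finsupp.single x 1) =
      c (x i) • Finsupp.single x 1 := by
  simp only [block, Finsupp.linearCombination_single, one_smul, if_neg h.not_lt, if_neg h.not_gt]

theorem hom_ext_words {V : Type*} [AddCommGroup V] [Module k V] {f g : ((ℕ → ℕ) →₀ k) →ₗ[k] V}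
    (h : ∀ x, f (Finsupp.single x 1) = g (Finsupp.single x 1)) : f = g :=
  Finsupp.lhom_ext' fun x => LinearMap.ext_ring (h x)

theorem block_mul (i : ℕ) (A B : Matrix (Fin 2) (Fin 2) k) (c d : ℕ → k) :
    block i A c * block i B d = block i (A * B) (c * d) := by
  refine hom_ext_words fun x => ?_
  rw [Module.End.mul_apply]
  rcases lt_trichotomy (x i) (x (i + 1)) with h | h | h
  · have h' : exchange i x (i + 1) < exchange i x i := by simpa
    simp only [block_of_lt _ _ h, map_add, map_smul, block_of_gt _ _ h', exchange_exchange,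
      Matrix.mul_apply, Fin.sum_univ_two]
    module
  · simp only [block_of_eq _ _ h, map_smul, Pi.mul_apply]
    module
  · have h' : exchange i x i < exchange i x (i + 1) := by simpa
    simp only [block_of_gt _ _ h, map_add, map_smul, block_of_lt _ _ h', exchange_exchange,
      Matrix.mul_apply, Fin.sum_univ_two]
    module

theorem block_one (i : ℕ) : block i (1 : Matrix (Fin 2) (Fin 2) k) 1 = 1 := by
  refine hom_ext_words fun x => ?_
  rcases lt_trichotomy (x i) (x (i + 1)) with h | h | h
  · simp [block_of_lt _ _ h]
  · simp [block_of_eq _ _ h]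
  · simp [block_of_gt _ _ h]

theorem block_add (i : ℕ) (A B : Matrix (Fin 2) (Fin 2) k) (c d : ℕ → k) :
    block i A c + block i B d = block i (A + B) (c + d) := by
  refine hom_ext_words fun x => ?_
  rw [LinearMap.add_apply]
  rcases lt_trichotomy (x i) (x (i + 1)) with h | h | h
  · simp only [block_of_lt _ _ h, Matrix.add_apply]; module
  · simp only [block_of_eq _ _ h, Pi.add_apply]; module
  · simp only [block_of_gt _ _ h, Matrix.add_apply]; module

theorem block_smul (i : ℕ) (r : k) (A : Matrix (Fin 2) (Fin 2) k) (c : ℕ → k) :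
    r • block i A c = block i (r • A) (r • c) := by
  refine hom_ext_words fun x => ?_
  rw [LinearMap.smul_apply]
  rcases lt_trichotomy (x i) (x (i + 1)) with h | h | h
  · simp only [block_of_lt _ _ h, Matrix.smul_apply, smul_add, smul_smul, smul_eq_mul]
  · simp only [block_of_eq _ _ h, Pi.smul_apply, smul_smul, smul_eq_mul]
  · simp only [block_of_gt _ _ h, Matrix.smul_apply, smul_add, smul_smul, smul_eq_mul]

theorem block_sub (i : ℕ) (A B : Matrix (Fin 2) (Fin 2) k) (c d : ℕ → k) :
    block i A c - block i B d = block i (A - B) (c - d) := by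
  refine hom_ext_words fun x => ?_
  rw [LinearMap.sub_apply]
  rcases lt_trichotomy (x i) (x (i + 1)) with h | h | h
  · simp only [block_of_lt _ _ h, Matrix.sub_apply]; module
  · simp only [block_of_eq _ _ h, Pi.sub_apply]; module
  · simp only [block_of_gt _ _ h, Matrix.sub_apply]; module

theorem block_zero (i : ℕ) : block i (0 : Matrix (Fin 2) (Fin 2) k) 0 = 0 := by
  simpa using (block_smul i (0 : k) 0 0).symm

theorem algebraMap_eq_block (i : ℕ) (r : k) :
    algebraMap k (Module.End k ((ℕ → ℕ) →₀ k)) r = block i (r • 1) (r • 1) := by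
  rw [← block_smul, block_one, Algebra.algebraMap_eq_smul_one]

theorem block_comm {i j : ℕ} (hij : i + 1 < j) (A B : Matrix (Fin 2) (Fin 2) k) (c d : ℕ → k) :
    block i A c * block j B d = block j B d * block i A c := by
  refine hom_ext_words fun x => ?_
  have e1 : exchange j x i = x i := exchange_of_ne _ _ (by omega) (by omega)
  have e2 : exchange j x (i + 1) = x (i + 1) := exchange_of_ne _ _ (by omega) (by omega)
  have e3 : exchange i x j = x j := exchange_of_ne _ _ (by omega) (by omega)
  have e4 : exchange i x (j + 1) = x (j + 1) := exchange_of_ne _ _ (by omega) (by omega)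
  rw [Module.End.mul_apply, Module.End.mul_apply]
  rcases lt_trichotomy (x i) (x (i + 1)) with h | h | h <;>
  rcases lt_trichotomy (x j) (x (j + 1)) with h' | h' | h' <;>
  have h1 := h <;> have h1' := h' <;> rw [← e1, ← e2] at h1 <;> rw [← e3, ← e4] at h1' <;>
  simp only [block_of_lt, block_of_gt, block_of_eq, h, h', h1, h1', map_add, map_smul,
    exchange_comm hij, e1, e2, e3, e4] <;> module

/-- The action of a generator of the Hecke algebra on words, where `c a` is the eigenvalue on a
word with the letter `a` at both positions. -/
noncomputable def heckeOp (q : k) (c : ℕ → k) (i : ℕ) : Module.End k ((ℕ → ℕ) →₀ k) :=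
  block i !![0, q; 1, q - 1] c

/-- The rewriting rule at the positions `i` and `i + 1`: a descent `ba` becomes `β ab`, and a
repeated letter `aa` becomes `c a` times itself. -/
noncomputable def rewriteOp (β : k) (c : ℕ → k) (i : ℕ) : Module.End k ((ℕ → ℕ) →₀ k) :=
  block i !![1, β; 0, 0] c

theorem heckeOp_of_lt (q : k) (c : ℕ → k) {i : ℕ} {x : ℕ → ℕ} (h : x i < x (i + 1)) :
    heckeOp q c i (Finsupp.single x 1) = Finsupp.single (exchange i x) 1 := by
  rw [heckeOp, block_of_lt _ _ h]; simp

theorem heckeOp_of_gt (q : k) (c : ℕ → k) {i : ℕ} {x : ℕ → ℕ} (h : x (i + 1) < x i) :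
    heckeOp q c i (Finsupp.single x 1) =
      q • Finsupp.single (exchange i x) 1 + (q - 1) • Finsupp.single x 1 := by
  rw [heckeOp, block_of_gt _ _ h]; rfl

theorem heckeOp_of_eq (q : k) (c : ℕ → k) {i : ℕ} {x : ℕ → ℕ} (h : x i = x (i + 1)) :
    heckeOp q c i (Finsupp.single x 1) = c (x i) • Finsupp.single x 1 :=
  block_of_eq _ _ h

theorem rewriteOp_of_lt (β : k) (c : ℕ → k) {i : ℕ} {x : ℕ → ℕ} (h : x i < x (i + 1)) :
    rewriteOp β c i (Finsupp.single x 1) = Finsupp.single x 1 := by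
  rw [rewriteOp, block_of_lt _ _ h]; simp

theorem rewriteOp_of_gt (β : k) (c : ℕ → k) {i : ℕ} {x : ℕ → ℕ} (h : x (i + 1) < x i) :
    rewriteOp β c i (Finsupp.single x 1) = β • Finsupp.single (exchange i x) 1 := by
  rw [rewriteOp, block_of_gt _ _ h]; simp

theorem rewriteOp_of_eq (β : k) (c : ℕ → k) {i : ℕ} {x : ℕ → ℕ} (h : x i = x (i + 1)) :
    rewriteOp β c i (Finsupp.single x 1) = c (x i) • Finsupp.single x 1 :=
  block_of_eq _ _ h

/-- The braid relation is checked on words with all possible orders of three adjacent letters; the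
eigenvalue equation is needed for those with exactly two equal letters. -/
theorem heckeOp_braid {q : k} {c : ℕ → k} (hc : ∀ a, (c a - q) * (c a + 1) = 0) (i : ℕ) :
    heckeOp q c i * heckeOp q c (i + 1) * heckeOp q c i =
      heckeOp q c (i + 1) * heckeOp q c i * heckeOp q c (i + 1) := by
  refine hom_ext_words fun x => ?_
  have hi := hc (x (i + 2))
  have hi' := hc (x (i + 1))
  simp only [Module.End.mul_apply]
  rcases lt_trichotomy (x i) (x (i + 1)) with h | h | h <;>
  rcases lt_trichotomy (x (i + 1)) (x (i + 2)) with h' | h' | h' <;>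
  rcases lt_trichotomy (x i) (x (i + 2)) with h'' | h'' | h'' <;>
  first
  | omega
  | simp only [heckeOp_of_lt, heckeOp_of_gt, heckeOp_of_eq, h, h', h'', exchange_braid, map_add,
      map_smul, exchange_left, exchange_right, exchange_add_two, exchange_succ_self,
      exchange_exchange]
    try match_scalars
    all_goals first
    | ring1
    | linear_combination hi
    | linear_combination -hi'
    | linear_combination (1 - q) * hi
    | linear_combination (q - 1) * hi'

/-- The rewriting rules are confluent: both sides compute the normal form of three adjacent
letters. -/
theorem rewriteOp_braid {β : k} {c : ℕ → k} (hc : ∀ a, c a * c a = c a) (i : ℕ) :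
    rewriteOp β c i * rewriteOp β c (i + 1) * rewriteOp β c i =
      rewriteOp β c (i + 1) * rewriteOp β c i * rewriteOp β c (i + 1) := by
  refine hom_ext_words fun x => ?_
  have hi := hc (x (i + 2))
  have hi' := hc (x (i + 1))
  simp only [Module.End.mul_apply]
  rcases lt_trichotomy (x i) (x (i + 1)) with h | h | h <;>
  rcases lt_trichotomy (x (i + 1)) (x (i + 2)) with h' | h' | h' <;>
  rcases lt_trichotomy (x i) (x (i + 2)) with h'' | h'' | h'' <;>
  first
  | omega
  | simp only [rewriteOp_of_lt, rewriteOp_of_gt, rewriteOp_of_eq, h, h', h'', exchange_braid,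
      map_smul, exchange_left, exchange_right, exchange_add_two, exchange_succ_self]
    try match_scalars
    all_goals first
    | ring1
    | linear_combination β * hi
    | linear_combination -hi
    | linear_combination hi'

theorem heckeOp_quad {q : k} {c : ℕ → k} (hc : ∀ a, (c a - q) * (c a + 1) = 0) (i : ℕ) :
    (heckeOp q c i - algebraMap k _ q) * (heckeOp q c i + 1) = 0 := by
  rw [algebraMap_eq_block i, ← block_one i, heckeOp, block_sub, block_add, block_mul,
    ← block_zero i]
  congr 1
  · ext a b
    fin_cases a <;> fin_cases b <;> simp [Matrix.mul_apply, Fin.sum_univ_two]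
  · ext a
    simpa using hc a

theorem rewriteOp_idem {β : k} {c : ℕ → k} (hc : ∀ a, c a * c a = c a) (i : ℕ) :
    rewriteOp β c i * rewriteOp β c i = rewriteOp β c i := by
  rw [rewriteOp, block_mul]
  congr 1
  · ext a b
    fin_cases a <;> fin_cases b <;> simp [Matrix.mul_apply, Fin.sum_univ_two]
  · exact funext hc

theorem rewriteOp_isZeroHecke {n : ℕ} {β : k} {c : ℕ → k} (hc : ∀ a, c a * c a = c a) :
    IsZeroHecke fun i : Set.Ioo 0 n => rewriteOp β c i.1 where
  idem i := rewriteOp_idem hc i.1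
  braid i _ h := h ▸ rewriteOp_braid hc i.1
  comm _ _ h := block_comm h _ _ _ _

/-- The kernel of `T_i - q` on words consists of the tensors that are reduced to zero by the
rules `ba ↦ -ab` for `a < b`, and `aa ↦ 0` for the letters `a` with eigenvalue `q`. -/
theorem ker_heckeOp_sub (q : k) (c : ℕ → k) (i : ℕ) :
    LinearMap.ker (heckeOp q c i - algebraMap k _ q) =
      LinearMap.ker (rewriteOp (-1) (fun a => (c a - q)⁻¹ * (c a - q)) i) := by
  have h1 : (heckeOp q c i - algebraMap k _ q) =
      (heckeOp q c i - algebraMap k _ q) *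
        rewriteOp (-1) (fun a => (c a - q)⁻¹ * (c a - q)) i := by
    rw [algebraMap_eq_block i, heckeOp, rewriteOp, block_sub, block_mul]
    congr 1
    · ext a b
      fin_cases a <;> fin_cases b <;> simp [Matrix.mul_apply, Fin.sum_univ_two]
    · ext a
      by_cases h : c a - q = 0 <;> simp [h]
  -- The matrix unit maps the larger word of a pair to the smaller one.
  have h2 : rewriteOp (-1) (fun a => (c a - q)⁻¹ * (c a - q)) i =
      block i !![0, 1; 0, 0] (fun a => (c a - q)⁻¹) * (heckeOp q c i - algebraMap k _ q) := by
    rw [algebraMap_eq_block i, heckeOp, rewriteOp, block_sub, block_mul]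
    congr 1
    · ext a b
      fin_cases a <;> fin_cases b <;> simp [Matrix.mul_apply, Fin.sum_univ_two]
    · ext a
      simp
  apply le_antisymm
  · rw [h2]; exact LinearMap.ker_le_ker_comp _ _
  · conv_rhs => rw [h1]
    exact LinearMap.ker_le_ker_comp _ _

/-- If `P * X = 0` and `1 - P` is a right multiple of `X`, then the range of `X` is the kernel of
`P`. -/
theorem range_eq_ker_of_mul {V : Type*} [AddCommGroup V] [Module k V] {X P Y : Module.End k V}
    (h : P * X = 0) (h' : 1 - P = X * Y) : LinearMap.range X = LinearMap.ker P := by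
  apply le_antisymm
  · rintro _ ⟨m, rfl⟩
    exact LinearMap.congr_fun h m
  · intro m hm
    have := LinearMap.congr_fun h' m
    rw [LinearMap.sub_apply, LinearMap.mem_ker.1 hm, sub_zero] at this
    exact ⟨Y m, this.symm⟩

/-- The rules are `ba ↦ -ab` for `a < b`, and `aa ↦ 0` for the letters `a` with eigenvalue
different from `-1`. -/
theorem range_heckeOp_add (q : k) (c : ℕ → k) (i : ℕ) :
    LinearMap.range (heckeOp q c i + 1) =
      LinearMap.ker (rewriteOp (-1) (fun a => 1 - (c a + 1) * (c a + 1)⁻¹) i) := by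
  -- The matrix unit maps the larger word of a pair to the smaller one, which `T_i + 1` maps to the
  -- sum of both.
  refine range_eq_ker_of_mul (Y := block i !![0, 1; 0, 0] fun a => (c a + 1)⁻¹) ?_ ?_
  · rw [← block_one i, heckeOp, rewriteOp, block_add, block_mul, ← block_zero i]
    congr 1
    · ext a b
      fin_cases a <;> fin_cases b <;> simp [Matrix.mul_apply, Fin.sum_univ_two]
    · ext a
      by_cases h : c a + 1 = 0 <;> simp [h]
  · rw [← block_one i, heckeOp, rewriteOp, block_add, block_sub, block_mul]
    congr 1
    · ext a b
      fin_cases a <;> fin_cases b <;> simp [Matrix.mul_apply, Fin.sum_univ_two]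
    · ext a
      simp

/-- The rules are `ba ↦ q ab` for `a < b`, and `aa ↦ 0` for the letters `a` with eigenvalue
different from `q`. -/
theorem range_heckeOp_sub (q : k) (c : ℕ → k) (i : ℕ) :
    LinearMap.range (heckeOp q c i - algebraMap k _ q) =
      LinearMap.ker (rewriteOp q (fun a => 1 - (c a - q) * (c a - q)⁻¹) i) := by
  refine range_eq_ker_of_mul (Y := block i !![0, 1; 0, 0] fun a => (c a - q)⁻¹) ?_ ?_
  · rw [algebraMap_eq_block i, heckeOp, rewriteOp, block_sub, block_mul, ← block_zero i]
    congr 1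
    · ext a b
      fin_cases a <;> fin_cases b <;> simp [Matrix.mul_apply, Fin.sum_univ_two]
    · ext a
      by_cases h : c a - q = 0 <;> simp [h]
  · rw [algebraMap_eq_block i, ← block_one i, heckeOp, rewriteOp, block_sub, block_sub, block_mul]
    congr 1
    · ext a b
      fin_cases a <;> fin_cases b <;> simp [Matrix.mul_apply, Fin.sum_univ_two]
    · ext a
      simp

end Words

/-! ### Presentation of the Hecke algebra and its action on words -/

section Presentation

variable {k : Type*} [Field k] {q : k} {n : ℕ}

theorem T_braid (i j : Set.Ioo 0 n) (h : i.1 + 1 = j.1) :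
    T k q i * T k q j * T k q i = T k q j * T k q i * T k q j := by
  have h := RingQuot.mkAlgHom_rel k (Rel.braid (q := q) i j h)
  simp only [map_mul] at h
  exact h

theorem T_comm (i j : Set.Ioo 0 n) (h : i.1 + 1 < j.1) :
    T k q i * T k q j = T k q j * T k q i := by
  have h := RingQuot.mkAlgHom_rel k (Rel.comm (q := q) i j h)
  simp only [map_mul] at h
  exact h

theorem T_quad (i : Set.Ioo 0 n) :
    (T k q i - algebraMap k (Hecke k q n) q) * (T k q i + 1) = 0 := by
  have h := RingQuot.mkAlgHom_rel k (Rel.quad (q := q) i)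
  rw [map_mul, map_sub, map_add, map_one, map_zero, AlgHom.commutes] at h
  exact h

/-- The Hecke algebra acts through operators satisfying the defining relations. -/
noncomputable def heckeLift {B : Type*} [Ring B] [Algebra k B] (t : Set.Ioo 0 n → B)
    (hb : ∀ i j : Set.Ioo 0 n, i.1 + 1 = j.1 → t i * t j * t i = t j * t i * t j)
    (hc : ∀ i j : Set.Ioo 0 n, i.1 + 1 < j.1 → t i * t j = t j * t i)
    (hq : ∀ i, (t i - algebraMap k B q) * (t i + 1) = 0) : Hecke k q n →ₐ[k] B :=
  RingQuot.liftAlgHom k ⟨FreeAlgebra.lift k t, by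
    intro a b h
    cases h with
    | braid i j h => simpa using hb i j h
    | comm i j h => simpa using hc i j h
    | quad i => simpa using hq i⟩

theorem heckeLift_T {B : Type*} [Ring B] [Algebra k B] (t : Set.Ioo 0 n → B)
    (hb : ∀ i j : Set.Ioo 0 n, i.1 + 1 = j.1 → t i * t j * t i = t j * t i * t j)
    (hc : ∀ i j : Set.Ioo 0 n, i.1 + 1 < j.1 → t i * t j = t j * t i)
    (hq : ∀ i, (t i - algebraMap k B q) * (t i + 1) = 0) (i : Set.Ioo 0 n) :
    heckeLift (q := q) t hb hc hq (T k q i) = t i := by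
  have h := RingQuot.liftAlgHom_mkAlgHom_apply k (s := Rel k q n) (FreeAlgebra.lift k t) (by
    intro a b h
    cases h with
    | braid i j h => simpa using hb i j h
    | comm i j h => simpa using hc i j h
    | quad i => simpa using hq i) (FreeAlgebra.ι k i)
  rw [FreeAlgebra.lift_ι_apply] at h
  exact h

theorem hecke_induction {p : Hecke k q n → Prop} (h1 : ∀ r, p (algebraMap k _ r))
    (h2 : ∀ i, p (T k q i)) (h3 : ∀ a b, p a → p b → p (a + b))
    (h4 : ∀ a b, p a → p b → p (a * b)) (a : Hecke k q n) : p a := by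
  obtain ⟨a, rfl⟩ := RingQuot.mkAlgHom_surjective k (Rel k q n) a
  induction a with
  | grade0 r => rw [AlgHom.commutes]; exact h1 r
  | grade1 i => exact h2 i
  | mul a b ha hb => rw [map_mul]; exact h4 _ _ ha hb
  | add a b ha hb => rw [map_add]; exact h3 _ _ ha hb

/-- A labelling of the letters by the two possible eigenvalues `q` and `-1`. -/
abbrev Labelling (q : k) : Type _ := ℕ → {a : k // (a - q) * (a + 1) = 0}

/-- The space with basis the words in `ℕ`, on which the Hecke algebra acts by `heckeOp`. -/
def WordModule (q : k) (_n : ℕ) (_c : Labelling q) : Type _ := (ℕ → ℕ) →₀ k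

variable {c : Labelling q}

noncomputable instance : AddCommGroup (WordModule q n c) :=
  inferInstanceAs (AddCommGroup ((ℕ → ℕ) →₀ k))

noncomputable instance : Module k (WordModule q n c) :=
  inferInstanceAs (Module k ((ℕ → ℕ) →₀ k))

/-- The action of the Hecke algebra on words. -/
noncomputable def wordRep (c : Labelling q) : Hecke k q n →ₐ[k] Module.End k ((ℕ → ℕ) →₀ k) :=
  heckeLift (fun i => heckeOp q (fun a => (c a).1) i.1)
    (fun i _ h => h ▸ heckeOp_braid (fun a => (c a).2) i.1)
    (fun _ _ h => block_comm h _ _ _ _) (fun i => heckeOp_quad (fun a => (c a).2) i.1)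

theorem wordRep_T (i : Set.Ioo 0 n) :
    wordRep c (T k q i) = heckeOp q (fun a => (c a).1) i.1 :=
  heckeLift_T ..

noncomputable instance : Module (Hecke k q n) (WordModule q n c) :=
  Module.compHom ((ℕ → ℕ) →₀ k) (wordRep c).toRingHom

/-- The word module as a space of formal combinations of words. -/
noncomputable def wordEquiv (q : k) (n : ℕ) (c : Labelling q) :
    WordModule q n c ≃ₗ[k] ((ℕ → ℕ) →₀ k) :=
  LinearEquiv.refl k ((ℕ → ℕ) →₀ k)

theorem wordEquiv_smul (a : Hecke k q n) (m : WordModule q n c) :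
    wordEquiv q n c (a • m) = wordRep c a (wordEquiv q n c m) :=
  rfl

instance : IsScalarTower k (Hecke k q n) (WordModule q n c) where
  smul_assoc r a m := by
    apply (wordEquiv q n c).injective
    rw [wordEquiv_smul, map_smul, map_smul, wordEquiv_smul, LinearMap.smul_apply]

/-- The basis element of a word. -/
noncomputable def word (q : k) (n : ℕ) (c : Labelling q) (x : ℕ → ℕ) : WordModule q n c :=
  (wordEquiv q n c).symm (Finsupp.single x 1)

theorem op_apply {M : Type*} [AddCommGroup M] [Module k M] [Module (Hecke k q n) M]
    [IsScalarTower k (Hecke k q n) M] (a : Hecke k q n) (m : M) : op M a m = a • m :=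
  rfl

theorem splits_word {U : Set.Ioo 0 n → Submodule k ((ℕ → ℕ) →₀ k)} (hU : Splits U LinearMap.id) :
    Splits (fun i => (U i).comap (wordEquiv q n c).toLinearMap) LinearMap.id := by
  have h := hU.of_factor (U := fun i => (U i).comap (wordEquiv q n c).toLinearMap)
    (f := (wordEquiv q n c).toLinearMap) (g := (wordEquiv q n c).symm.toLinearMap)
    (fun i => le_rfl) (fun i m hm => by simpa using hm)
  rwa [LinearEquiv.symm_comp] at h

theorem ker_op_word (a : Hecke k q n) : LinearMap.ker (op (WordModule q n c) a) =
    (LinearMap.ker (wordRep c a)).comap (wordEquiv q n c).toLinearMap := by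
  ext m
  rw [LinearMap.mem_ker, op_apply, Submodule.mem_comap, LinearMap.mem_ker,
    LinearEquiv.coe_coe, ← wordEquiv_smul, LinearEquiv.map_eq_zero_iff]

theorem range_op_word (a : Hecke k q n) : LinearMap.range (op (WordModule q n c) a) =
    (LinearMap.range (wordRep c a)).comap (wordEquiv q n c).toLinearMap := by
  ext m
  constructor
  · rintro ⟨w, rfl⟩
    exact ⟨wordEquiv q n c w, (wordEquiv_smul a w).symm⟩
  · rintro ⟨w, hw⟩
    refine ⟨(wordEquiv q n c).symm w, (wordEquiv q n c).injective ?_⟩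
    rw [op_apply, wordEquiv_smul, LinearEquiv.apply_symm_apply, hw, LinearEquiv.coe_coe]

theorem splits_word_ker_sub : Splits (fun i : Set.Ioo 0 n => LinearMap.ker
    (op (WordModule q n c) (T k q i - algebraMap k (Hecke k q n) q))) LinearMap.id := by
  simp only [ker_op_word, map_sub, wordRep_T, AlgHom.commutes, ker_heckeOp_sub]
  refine splits_word (rewriteOp_isZeroHecke fun a => ?_).splits
  by_cases h : (c a).1 - q = 0 <;> simp [h]

theorem splits_word_range_add : Splits (fun i : Set.Ioo 0 n => LinearMap.range
    (op (WordModule q n c) (T k q i + 1))) LinearMap.id := by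
  simp only [range_op_word, map_add, wordRep_T, map_one, range_heckeOp_add]
  refine splits_word (rewriteOp_isZeroHecke fun a => ?_).splits
  by_cases h : (c a).1 + 1 = 0 <;> simp [h]

theorem splits_word_range_sub : Splits (fun i : Set.Ioo 0 n => LinearMap.range
    (op (WordModule q n c) (T k q i - algebraMap k (Hecke k q n) q))) LinearMap.id := by
  simp only [range_op_word, map_sub, wordRep_T, AlgHom.commutes, range_heckeOp_sub]
  refine splits_word (rewriteOp_isZeroHecke fun a => ?_).splits
  by_cases h : (c a).1 - q = 0 <;> simp [h]

end Presentation

/-! ### Maps out of the word module -/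

section WordMap

variable {k : Type*} [Field k] {q : k} {n : ℕ} {V : Type*} [AddCommGroup V]

/-- Decreases when the letters of a descent are exchanged. -/
def wordWeight (n : ℕ) (x : ℕ → ℕ) : ℕ := ∑ p ∈ Finset.range (n + 1), (n - p) * x p

theorem wordWeight_exchange {i : ℕ} (hi : i < n) {x : ℕ → ℕ} (h : x (i + 1) < x i) :
    wordWeight n (exchange i x) < wordWeight n x := by
  have hd : ∀ y : ℕ → ℕ, wordWeight n y = (n - i) * y i + (n - (i + 1)) * y (i + 1) +
      ∑ p ∈ ((Finset.range (n + 1)).erase i).erase (i + 1), (n - p) * y p := fun y => by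
    rw [wordWeight, ← Finset.add_sum_erase _ _ (Finset.mem_range.2 (show i < n + 1 by omega)),
      ← Finset.add_sum_erase _ _ (Finset.mem_erase.2 ⟨Nat.succ_ne_self i,
        Finset.mem_range.2 (show i + 1 < n + 1 by omega)⟩), add_assoc]
  rw [hd, hd x, exchange_left, exchange_right]
  have hr : ∑ p ∈ ((Finset.range (n + 1)).erase i).erase (i + 1), (n - p) * exchange i x p =
      ∑ p ∈ ((Finset.range (n + 1)).erase i).erase (i + 1), (n - p) * x p := by
    refine Finset.sum_congr rfl fun p hp => ?_
    simp only [Finset.mem_erase] at hp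
    rw [exchange_of_ne _ _ hp.2.1 hp.1]
  rw [hr, show n - i = (n - (i + 1)) + 1 by omega]
  nlinarith

open Classical in
/-- The image of the word `x` under the homomorphism that sends the word `x₀` to `v`: a descent of
`x` is chosen and the generator at this position is split off. Words without descents other than
`x₀` are sent to zero. -/
noncomputable def wordImage (q : k) (n : ℕ) [Module (Hecke k q n) V] (x₀ : ℕ → ℕ) (v : V)
    (x : ℕ → ℕ) : V :=
  if h : ∃ i : Set.Ioo 0 n, x (i.1 + 1) < x i.1 then
    T k q h.choose • wordImage q n x₀ v (exchange h.choose.1 x)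
  else if x = x₀ then v else 0
termination_by wordWeight n x
decreasing_by exact wordWeight_exchange h.choose.2.2 h.choose_spec

variable [Module (Hecke k q n) V] (x₀ : ℕ → ℕ) (v : V)

/-- The choice of a descent in `wordImage` does not matter: two descents are compared by splitting
off the longest element of the parabolic subgroup that they generate. -/
theorem wordImage_of_gt (x : ℕ → ℕ) (i : Set.Ioo 0 n) (hi : x (i.1 + 1) < x i.1) :
    wordImage q n x₀ v x = T k q i • wordImage q n x₀ v (exchange i.1 x) := by
  induction hN : wordWeight n x using Nat.strong_induction_on generalizing x i with
  | _ N ih =>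
    subst hN
    -- two descents `i < j` give the same result
    have key : ∀ i j : Set.Ioo 0 n, i.1 < j.1 → x (i.1 + 1) < x i.1 → x (j.1 + 1) < x j.1 →
        T k q i • wordImage q n x₀ v (exchange i.1 x) =
          T k q j • wordImage q n x₀ v (exchange j.1 x) := by
      intro i j hij hi hj
      have wi := wordWeight_exchange i.2.2 hi
      have wj := wordWeight_exchange j.2.2 hj
      rcases Nat.lt_or_ge (i.1 + 1) j.1 with hlt | hge
      · have e1 : exchange j.1 x i.1 = x i.1 := exchange_of_ne _ _ (by omega) (by omega)
        have e2 : exchange j.1 x (i.1 + 1) = x (i.1 + 1) := exchange_of_ne _ _ (by omega) (by omega)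
        have e3 : exchange i.1 x j.1 = x j.1 := exchange_of_ne _ _ (by omega) (by omega)
        have e4 : exchange i.1 x (j.1 + 1) = x (j.1 + 1) := exchange_of_ne _ _ (by omega) (by omega)
        rw [ih _ wi (exchange i.1 x) j (by rwa [e3, e4]) rfl,
          ih _ wj (exchange j.1 x) i (by rwa [e1, e2]) rfl, smul_smul, smul_smul,
          T_comm i j hlt, exchange_comm hlt]
      · obtain ⟨i, hi'⟩ := i
        obtain ⟨j, hj'⟩ := j
        obtain rfl : j = i + 1 := by simp only at hij hge; omega
        simp only at hi hj wi wj ⊢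
        have hj2 : x (i + 2) < x (i + 1) := hj
        have f1 : exchange i x (i + 1 + 1) < exchange i x (i + 1) := by
          rw [exchange_right]; exact (exchange_add_two i x).trans_lt (hj2.trans hi)
        have f2 : exchange (i + 1) x (i + 1) < exchange (i + 1) x i := by
          rw [exchange_left, exchange_succ_self]; exact hj2.trans hi
        have w1 := wordWeight_exchange hj'.2 f1
        have w2 := wordWeight_exchange hi'.2 f2
        have f3 : exchange (i + 1) (exchange i x) (i + 1) < exchange (i + 1) (exchange i x) i := by
          rw [exchange_left, exchange_succ_self, exchange_left]
          exact (exchange_add_two i x).trans_lt hj2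
        have f4 : exchange i (exchange (i + 1) x) (i + 1 + 1) <
            exchange i (exchange (i + 1) x) (i + 1) := by
          rw [exchange_right, exchange_succ_self]
          refine (exchange_add_two i _).trans_lt ?_
          exact (exchange_right (i + 1) x).trans_lt hi
        rw [ih _ wi (exchange i x) ⟨i + 1, hj'⟩ f1 rfl,
          ih _ (w1.trans wi) _ ⟨i, hi'⟩ f3 rfl,
          ih _ wj (exchange (i + 1) x) ⟨i, hi'⟩ f2 rfl,
          ih _ (w2.trans wj) _ ⟨i + 1, hj'⟩ f4 rfl]
        simp only [smul_smul, exchange_braid, ← mul_assoc]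
        rw [T_braid ⟨i, hi'⟩ ⟨i + 1, hj'⟩ rfl]
    have hex : ∃ i : Set.Ioo 0 n, x (i.1 + 1) < x i.1 := ⟨i, hi⟩
    rw [wordImage, dif_pos hex]
    rcases lt_trichotomy hex.choose.1 i.1 with h | h | h
    · exact key _ _ h hex.choose_spec hi
    · rw [Subtype.ext h]
    · exact (key _ _ h hi hex.choose_spec).symm

theorem T_smul_wordImage_of_lt (x : ℕ → ℕ) (i : Set.Ioo 0 n) (hi : x i.1 < x (i.1 + 1)) :
    T k q i • wordImage q n x₀ v x = wordImage q n x₀ v (exchange i.1 x) := by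
  rw [wordImage_of_gt x₀ v (exchange i.1 x) i (by simpa using hi), exchange_exchange]

theorem T_smul_wordImage_of_gt (x : ℕ → ℕ) (i : Set.Ioo 0 n) (hi : x (i.1 + 1) < x i.1) :
    T k q i • wordImage q n x₀ v x =
      algebraMap k (Hecke k q n) q • wordImage q n x₀ v (exchange i.1 x) +
        algebraMap k (Hecke k q n) (q - 1) • wordImage q n x₀ v x := by
  have h : T k q i * T k q i =
      algebraMap k (Hecke k q n) q + algebraMap k (Hecke k q n) (q - 1) * T k q i := by
    have h := T_quad (q := q) i
    rw [sub_mul, mul_add, mul_add, mul_one, mul_one, sub_eq_zero] at h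
    rw [map_sub, map_one, sub_mul, one_mul, ← add_sub_assoc, eq_sub_iff_add_eq, h, add_comm]
  rw [wordImage_of_gt x₀ v x i hi, smul_smul, smul_smul, h, add_smul]

/-- The descents of `x` are removed one by one. The braid relation carries the generator past an
adjacent descent, to the new position of the repeated letter. -/
theorem T_smul_wordImage_of_eq {c : Labelling q}
    (hv : ∀ i : Set.Ioo 0 n, x₀ i.1 = x₀ (i.1 + 1) →
      T k q i • v = algebraMap k (Hecke k q n) (c (x₀ i.1)).1 • v)
    (x : ℕ → ℕ) (i : Set.Ioo 0 n) (hi : x i.1 = x (i.1 + 1)) :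
    T k q i • wordImage q n x₀ v x =
      algebraMap k (Hecke k q n) (c (x i.1)).1 • wordImage q n x₀ v x := by
  induction hN : wordWeight n x using Nat.strong_induction_on generalizing x i with
  | _ N ih =>
    subst hN
    by_cases hex : ∃ j : Set.Ioo 0 n, x (j.1 + 1) < x j.1
    · obtain ⟨j, hj⟩ := hex
      have wj := wordWeight_exchange j.2.2 hj
      have hcen : ∀ (r : k) (a : Hecke k q n) (w : V),
          a • algebraMap k (Hecke k q n) r • w = algebraMap k (Hecke k q n) r • a • w :=
        fun r a w => by rw [smul_smul, smul_smul, Algebra.commutes]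
      have hne : i.1 ≠ j.1 := fun e => by rw [e] at hi; omega
      by_cases hfar : i.1 + 1 < j.1 ∨ j.1 + 1 < i.1
      · have e1 : exchange j.1 x i.1 = x i.1 := exchange_of_ne _ _ (by omega) (by omega)
        have e2 : exchange j.1 x (i.1 + 1) = x (i.1 + 1) := exchange_of_ne _ _ (by omega) (by omega)
        have hc : T k q i * T k q j = T k q j * T k q i := by
          rcases hfar with h | h
          · exact T_comm i j h
          · exact (T_comm j i h).symm
        rw [wordImage_of_gt x₀ v x j hj, smul_smul, hc, mul_smul,
          ih _ wj _ i (by rw [e1, e2, hi]) rfl, e1, hcen]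
      · have hnear : i.1 + 1 = j.1 ∨ j.1 + 1 = i.1 := by omega
        obtain ⟨i, hi'⟩ := i
        obtain ⟨j, hj'⟩ := j
        simp only at hi hj hnear wj ⊢
        rcases hnear with rfl | rfl
        · -- the letters `a, a, b` with `b < a`
          have hj2 : x (i + 2) < x (i + 1) := hj
          have e0 : exchange (i + 1) x (i + 1) = x (i + 2) := exchange_left (i + 1) x
          have e1 : exchange (i + 1) x (i + 2) = x (i + 1) := exchange_right (i + 1) x
          have f1 : exchange (i + 1) x (i + 1) < exchange (i + 1) x i := by
            rw [e0, exchange_succ_self, hi]; exact hj2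
          have w1 := wordWeight_exchange hi'.2 f1
          have g1 : exchange i (exchange (i + 1) x) (i + 1) = x i := by
            rw [exchange_right, exchange_succ_self]
          have g2 : exchange i (exchange (i + 1) x) (i + 1) =
              exchange i (exchange (i + 1) x) (i + 1 + 1) := by
            rw [g1, hi, ← e1]; exact (exchange_add_two i _).symm
          have := ih _ (w1.trans wj) _ ⟨i + 1, hj'⟩ g2 rfl
          rw [wordImage_of_gt x₀ v x ⟨i + 1, hj'⟩ hj,
            wordImage_of_gt x₀ v (exchange (i + 1) x) ⟨i, hi'⟩ f1, smul_smul, smul_smul,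
            T_braid ⟨i, hi'⟩ ⟨i + 1, hj'⟩ rfl, mul_smul, this, mul_smul]
          simp only [g1, hcen]
        · -- the letters `b, a, a` with `a < b`
          have hi2 : x (j + 1) = x (j + 2) := hi
          have e0 : exchange j x (j + 1) = x j := exchange_right j x
          have e1 : exchange j x (j + 2) = x (j + 2) := exchange_add_two j x
          have f1 : exchange j x (j + 1 + 1) < exchange j x (j + 1) := by
            rw [e0]; exact (exchange_add_two j x).trans_lt (hi2 ▸ hj)
          have w1 := wordWeight_exchange hi'.2 f1
          have g1 : exchange (j + 1) (exchange j x) j = x (j + 1) := by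
            rw [exchange_succ_self, exchange_left]
          have g2 : exchange (j + 1) (exchange j x) j =
              exchange (j + 1) (exchange j x) (j + 1) := by
            rw [g1, hi2, ← e1]; exact (exchange_left (j + 1) _).symm
          have := ih _ (w1.trans wj) _ ⟨j, hj'⟩ g2 rfl
          rw [wordImage_of_gt x₀ v x ⟨j, hj'⟩ hj,
            wordImage_of_gt x₀ v (exchange j x) ⟨j + 1, hi'⟩ f1, smul_smul, smul_smul,
            ← T_braid ⟨j, hj'⟩ ⟨j + 1, hi'⟩ rfl, mul_smul, this, mul_smul]
          simp only [g1, hcen]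
    · rw [wordImage, dif_neg hex]
      by_cases h : x = x₀
      · subst h
        rw [if_pos rfl]
        exact hv i hi
      · simp [if_neg h]

/-- Let `x₀` be a word without descents. A vector `v` on which every generator that fixes `x₀` acts
by the same scalar as on `x₀` is the image of `x₀` under a homomorphism. -/
theorem exists_hom_of_word {c : Labelling q}
    (hx₀ : ∀ i : Set.Ioo 0 n, x₀ i.1 ≤ x₀ (i.1 + 1))
    (hv : ∀ i : Set.Ioo 0 n, x₀ i.1 = x₀ (i.1 + 1) →
      T k q i • v = algebraMap k (Hecke k q n) (c (x₀ i.1)).1 • v) :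
    ∃ f : WordModule q n c →ₗ[Hecke k q n] V, f (word q n c x₀) = v := by
  let _ : Module k V := Module.compHom V (algebraMap k (Hecke k q n))
  have hk : ∀ (r : k) (w : V), algebraMap k (Hecke k q n) r • w = r • w := fun _ _ => rfl
  let f : ((ℕ → ℕ) →₀ k) →ₗ[k] V := Finsupp.linearCombination k (wordImage q n x₀ v)
  have hf1 : ∀ x, f (Finsupp.single x 1) = wordImage q n x₀ v x := fun x => by
    simp [f, Finsupp.linearCombination_single]
  have hT : ∀ (i : Set.Ioo 0 n) (m : (ℕ → ℕ) →₀ k),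
      f (heckeOp q (fun a => (c a).1) i.1 m) = T k q i • f m := by
    intro i m
    let t : V →ₗ[k] V :=
      { toFun := fun w => T k q i • w
        map_add' := smul_add _
        map_smul' := fun r w => by
          rw [RingHom.id_apply, ← hk, ← hk, smul_smul, smul_smul, Algebra.commutes] }
    have : f ∘ₗ heckeOp q (fun a => (c a).1) i.1 = t ∘ₗ f := by
      refine hom_ext_words fun x => ?_
      change f (heckeOp q (fun a => (c a).1) i.1 (Finsupp.single x 1)) =
        T k q i • f (Finsupp.single x 1)
      rcases lt_trichotomy (x i.1) (x (i.1 + 1)) with h | h | h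
      · rw [heckeOp_of_lt _ _ h, hf1, hf1, T_smul_wordImage_of_lt x₀ v x i h]
      · rw [heckeOp_of_eq _ _ h, map_smul, hf1, T_smul_wordImage_of_eq x₀ v hv x i h, hk]
      · rw [heckeOp_of_gt _ _ h, map_add, map_smul, map_smul, hf1, hf1,
          T_smul_wordImage_of_gt x₀ v x i h, hk, hk]
    exact LinearMap.congr_fun this m
  let e := wordEquiv q n c
  refine ⟨{ toFun := fun m => f (e m)
            map_add' := fun m m' => by rw [map_add, map_add]
            map_smul' := fun a => ?_ }, ?_⟩
  · induction a using hecke_induction with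
    | h1 r =>
      intro m
      rw [RingHom.id_apply, algebraMap_smul, hk, map_smul, map_smul]
    | h2 i =>
      intro m
      rw [wordEquiv_smul, wordRep_T, hT, RingHom.id_apply]
    | h3 a b ha hb =>
      intro m
      rw [add_smul, RingHom.id_apply, add_smul, map_add, map_add, ha, hb]; rfl
    | h4 a b ha hb =>
      intro m
      rw [mul_smul, RingHom.id_apply, mul_smul, ha, hb]; rfl
  · change f (e (e.symm (Finsupp.single x₀ 1))) = v
    rw [LinearEquiv.apply_symm_apply, hf1, wordImage, dif_neg, if_pos rfl]
    rintro ⟨i, hi⟩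
    exact (hx₀ i).not_gt hi

end WordMap

/-! ### Induced modules as direct summands of word modules -/

section InducedHom

universe u

variable {k : Type u} [Field k] {A : Type u} [Ring A] [Algebra k A] {B : Subalgebra k A}
  {χ : B →ₐ[k] k}

/-- The generator `1 ⊗ 1` of an induced module. -/
def inducedGen (B : Subalgebra k A) (χ : B →ₐ[k] k) : Induced B χ :=
  Submodule.Quotient.mk ((1 : A) ⊗ₜ[k] (1 : k))

theorem smul_inducedGen (b : B) :
    (b : A) • inducedGen B χ = algebraMap k A (χ b) • inducedGen B χ := by
  rw [inducedGen, ← Submodule.Quotient.mk_smul, ← Submodule.Quotient.mk_smul,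
    Submodule.Quotient.eq]
  refine Submodule.subset_span ⟨1, b, 1, ?_⟩
  rw [TensorProduct.smul_tmul', TensorProduct.smul_tmul', smul_eq_mul, smul_eq_mul, mul_one,
    mul_one, one_mul, Algebra.algebraMap_eq_smul_one, TensorProduct.smul_tmul, smul_eq_mul]

variable {N : Type*} [AddCommGroup N] [Module A N]

theorem induced_hom_ext {f g : Induced B χ →ₗ[A] N}
    (h : f (inducedGen B χ) = g (inducedGen B χ)) : f = g := by
  refine LinearMap.ext fun y => ?_
  obtain ⟨t, rfl⟩ := Submodule.Quotient.mk_surjective _ y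
  have ht : t = TensorProduct.AlgebraTensorModule.rid k A A t • ((1 : A) ⊗ₜ[k] (1 : k)) := by
    induction t with
    | zero => simp
    | add a b ha hb => rw [map_add, add_smul, ← ha, ← hb]
    | tmul a r =>
      rw [TensorProduct.AlgebraTensorModule.rid_tmul, TensorProduct.smul_tmul', smul_eq_mul,
        mul_one, TensorProduct.smul_tmul, smul_eq_mul, mul_one]
  rw [ht, Submodule.Quotient.mk_smul, map_smul, map_smul]
  exact congrArg _ h

/-- Frobenius reciprocity. -/
theorem exists_induced_hom (v : N) (hv : ∀ b : B, (b : A) • v = algebraMap k A (χ b) • v) :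
    ∃ f : Induced B χ →ₗ[A] N, f (inducedGen B χ) = v := by
  let g : A ⊗[k] k →ₗ[A] N :=
    LinearMap.toSpanSingleton A N v ∘ₗ (TensorProduct.AlgebraTensorModule.rid k A A).toLinearMap
  have hg : ∀ (a : A) (r : k), g (a ⊗ₜ r) = (r • a) • v := fun a r => rfl
  refine ⟨(balancing B χ).liftQ g ?_, ?_⟩
  · refine Submodule.span_le.2 ?_
    rintro _ ⟨a, b, r, rfl⟩
    rw [SetLike.mem_coe, LinearMap.mem_ker, map_sub, hg, hg, sub_eq_zero, ← smul_mul_assoc,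
      mul_smul, hv, smul_smul, ← Algebra.commutes, ← Algebra.smul_def, smul_smul]
  · change g _ = v
    rw [hg, one_smul, one_smul]

end InducedHom

section Retract

universe u

variable {k : Type u} [Field k] {q : k} {n : ℕ} (J : Set (Set.Ioo 0 n))

open Classical in
/-- The word whose letter at the position `p` is the first position of the block of `p`, where the
blocks are the orbits of the parabolic subgroup given by `J`. -/
noncomputable def blockStart : ℕ → ℕ
  | 0 => 0
  | p + 1 => if p ∈ Subtype.val '' J then blockStart p else p + 1

theorem blockStart_succ_of_mem {j : Set.Ioo 0 n} (hj : j ∈ J) :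
    blockStart J (j.1 + 1) = blockStart J j.1 := by
  rw [blockStart, if_pos ⟨j, hj, rfl⟩]

theorem blockStart_succ_of_notMem {p : ℕ} (hp : p ∉ Subtype.val '' J) :
    blockStart J (p + 1) = p + 1 := by
  rw [blockStart, if_neg hp]

theorem blockStart_le (p : ℕ) : blockStart J p ≤ p := by
  induction p with
  | zero => rfl
  | succ p ih =>
    by_cases hp : p ∈ Subtype.val '' J
    · rw [blockStart, if_pos hp]; omega
    · rw [blockStart_succ_of_notMem J hp]

theorem blockStart_eq_succ_iff (j : Set.Ioo 0 n) :
    blockStart J j.1 = blockStart J (j.1 + 1) ↔ j ∈ J := by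
  refine ⟨fun h => ?_, fun h => (blockStart_succ_of_mem J h).symm⟩
  by_contra hj
  have hj' : j.1 ∉ Subtype.val '' J := by rwa [Subtype.val_injective.mem_set_image]
  have := blockStart_le J j.1
  rw [h, blockStart_succ_of_notMem J hj'] at this
  omega

theorem blockStart_le_succ (p : ℕ) : blockStart J p ≤ blockStart J (p + 1) := by
  by_cases hp : p ∈ Subtype.val '' J
  · rw [blockStart, if_pos hp]
  · rw [blockStart_succ_of_notMem J hp]
    exact (blockStart_le J p).trans (Nat.le_succ p)

variable {J} (χ : parabolic k q J →ₐ[k] k)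

/-- The generator `T_j` as an element of a parabolic subalgebra. -/
noncomputable def parabolicT (q : k) {j : Set.Ioo 0 n} (hj : j ∈ J) : parabolic k q J :=
  ⟨T k q j, Algebra.subset_adjoin ⟨j, hj, rfl⟩⟩

theorem character_quad {j : Set.Ioo 0 n} (hj : j ∈ J) :
    (χ (parabolicT q hj) - q) * (χ (parabolicT q hj) + 1) = 0 := by
  have h : (parabolicT q hj - algebraMap k _ q) * (parabolicT q hj + 1) = 0 :=
    Subtype.ext (T_quad j)
  simpa using congrArg χ h

/-- This fails for `q = 0`, when the eigenvalues `0` and `-1` satisfy the braid relation. -/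
theorem character_eq_of_succ (hq : q ≠ 0) {i j : Set.Ioo 0 n} (hi : i ∈ J) (hj : j ∈ J)
    (h : i.1 + 1 = j.1) : χ (parabolicT q hi) = χ (parabolicT q hj) := by
  have hb : parabolicT q hi * parabolicT q hj * parabolicT q hi =
      parabolicT q hj * parabolicT q hi * parabolicT q hj := Subtype.ext (T_braid i j h)
  have hb := congrArg χ hb
  simp only [map_mul] at hb
  have hne : ∀ {l : Set.Ioo 0 n} (hl : l ∈ J), χ (parabolicT q hl) ≠ 0 := fun hl h0 => by
    have := character_quad χ hl
    rw [h0] at this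
    simp [hq] at this
  have := mul_ne_zero (hne hi) (hne hj)
  refine mul_left_cancel₀ this ?_
  linear_combination hb

open Classical in
/-- The letter `a` gets the eigenvalue of the generators at the positions of the block that starts
at `a`. -/
noncomputable def characterLabelling : Labelling q := fun a =>
  if h : ∃ j : Set.Ioo 0 n, j ∈ J ∧ j.1 = a then
    ⟨χ (parabolicT q h.choose_spec.1), character_quad χ h.choose_spec.1⟩
  else ⟨q, by simp⟩

theorem characterLabelling_self {j : Set.Ioo 0 n} (hj : j ∈ J) :
    (characterLabelling χ j.1).1 = χ (parabolicT q hj) := by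
  have h : ∃ l : Set.Ioo 0 n, l ∈ J ∧ l.1 = j.1 := ⟨j, hj, rfl⟩
  rw [characterLabelling, dif_pos h]
  simp only [show h.choose = j from Subtype.ext h.choose_spec.2]

theorem characterLabelling_blockStart (hq : q ≠ 0) {j : Set.Ioo 0 n} (hj : j ∈ J) :
    (characterLabelling χ (blockStart J j.1)).1 = χ (parabolicT q hj) := by
  obtain ⟨p, hp⟩ := j
  induction p with
  | zero => exact absurd hp.1 (lt_irrefl 0)
  | succ p ih =>
    by_cases h : p ∈ Subtype.val '' J
    · obtain ⟨l, hl, rfl⟩ := h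
      rw [← character_eq_of_succ χ hq hl hj rfl, ← ih l.2 hl]
      exact congrArg (fun a => (characterLabelling χ a).1) (blockStart_succ_of_mem J hl)
    · simp only [blockStart_succ_of_notMem J h]
      exact characterLabelling_self χ hj

/-- For `q ≠ 0` a module induced from a one-dimensional representation of a parabolic subalgebra is
a direct summand of a word module. -/
theorem exists_retract_induced (hq : q ≠ 0) :
    ∃ (c : Labelling q) (f : Induced (parabolic k q J) χ →ₗ[Hecke k q n] WordModule q n c)
      (g : WordModule q n c →ₗ[Hecke k q n] Induced (parabolic k q J) χ),
      g ∘ₗ f = LinearMap.id := by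
  set c := characterLabelling χ with hc
  have hw : ∀ b : parabolic k q J, (b : Hecke k q n) • word q n c (blockStart J) =
      algebraMap k (Hecke k q n) (χ b) • word q n c (blockStart J) := by
    rintro ⟨b, hb⟩
    induction hb using Algebra.adjoin_induction with
    | mem b hb =>
      obtain ⟨j, hj, rfl⟩ := hb
      rw [algebraMap_smul]
      apply (wordEquiv q n c).injective
      refine ((wordEquiv_smul _ _).trans ?_).trans (LinearEquiv.map_smul _ _ _).symm
      simp only [wordRep_T]
      change heckeOp q _ j.1 (Finsupp.single _ 1) = _ • Finsupp.single _ 1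
      rw [heckeOp_of_eq _ _ ((blockStart_eq_succ_iff J j).2 hj),
        characterLabelling_blockStart χ hq hj]
      rfl
    | algebraMap r =>
      have : (⟨algebraMap k _ r, Subalgebra.algebraMap_mem _ r⟩ : parabolic k q J) =
        algebraMap k _ r := rfl
      rw [this, AlgHom.commutes]; rfl
    | add a b ha hb iha ihb =>
      have : (⟨a + b, add_mem ha hb⟩ : parabolic k q J) = ⟨a, ha⟩ + ⟨b, hb⟩ := rfl
      rw [this, map_add, map_add, add_smul, ← iha, ← ihb, ← add_smul]
      rfl
    | mul a b ha hb iha ihb =>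
      have : (⟨a * b, mul_mem ha hb⟩ : parabolic k q J) = ⟨a, ha⟩ * ⟨b, hb⟩ := rfl
      rw [this, map_mul, mul_comm, map_mul, mul_smul, ← iha, smul_smul, Algebra.commutes,
        mul_smul, ← ihb, smul_smul]
      rfl
  obtain ⟨f, hf⟩ := exists_induced_hom _ hw
  obtain ⟨g, hg⟩ := exists_hom_of_word (blockStart J) (inducedGen (parabolic k q J) χ) (c := c)
    (fun i => blockStart_le_succ J i.1) (fun i hi => by
      have hi := (blockStart_eq_succ_iff J i).1 hi
      rw [hc, characterLabelling_blockStart χ hq hi]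
      exact smul_inducedGen (parabolicT q hi))
  refine ⟨c, f, g, induced_hom_ext ?_⟩
  rw [LinearMap.comp_apply, hf, hg, LinearMap.id_apply]

end Retract

/-! ### Decomposition into indecomposable summands -/

section Decomposition

universe u v

variable {k : Type u} [Field k] {q : k} {n : ℕ} {M : Type v} [AddCommGroup M] [Module k M]
  [Module (Hecke k q n) M] [IsScalarTower k (Hecke k q n) M]

/-- The reduction to word modules, for subspaces `U` and `V` that depend functorially on the module.
The summands are split further until they are indecomposable, and the corresponding endomorphisms
of `M` factor through word modules. -/
theorem splits_of_summands [FiniteDimensional k M] (hq : q ≠ 0)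
    (hM : SummandsHaveOneDimSources k q n M) {U : Set.Ioo 0 n → Submodule k M}
    {V : ∀ c : Labelling q, Set.Ioo 0 n → Submodule k (WordModule q n c)}
    (hV : ∀ c, Splits (V c) LinearMap.id)
    (hUV : ∀ (c : Labelling q) (f : M →ₗ[Hecke k q n] WordModule q n c) (i : Set.Ioo 0 n),
      U i ≤ (V c i).comap (f.restrictScalars k))
    (hVU : ∀ (c : Labelling q) (f : WordModule q n c →ₗ[Hecke k q n] M) (i : Set.Ioo 0 n),
      V c i ≤ (U i).comap (f.restrictScalars k)) :
    Splits U LinearMap.id := by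
  have : IsArtinian (Hecke k q n) M := isArtinian_of_tower k inferInstance
  have key : ∀ N N' : Submodule (Hecke k q n) M, IsCompl N N' →
      ∀ f : M →ₗ[Hecke k q n] M, (∀ m, f m ∈ N) → Splits U (f.restrictScalars k) := by
    intro N
    induction N using WellFoundedLT.induction with
    | _ N ih =>
      intro N' hN f hf
      by_cases hind : Indecomposable (Hecke k q n) N
      · obtain ⟨J, χ, P, Q, hPQ, ⟨e⟩⟩ := hM N N' hN hind
        obtain ⟨c, a, b, hab⟩ := exists_retract_induced χ hq
        let g : M →ₗ[Hecke k q n] WordModule q n c :=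
          a ∘ₗ P.subtype ∘ₗ e.toLinearMap ∘ₗ f.codRestrict N hf
        let h : WordModule q n c →ₗ[Hecke k q n] M :=
          N.subtype ∘ₗ e.symm.toLinearMap ∘ₗ P.projectionOnto Q hPQ ∘ₗ b
        have hgh : f.restrictScalars k = h.restrictScalars k ∘ₗ g.restrictScalars k := by
          ext m
          have h1 : b (a (P.subtype (e (f.codRestrict N hf m)))) =
              P.subtype (e (f.codRestrict N hf m)) := LinearMap.congr_fun hab _
          change f m = N.subtype (e.symm (P.projectionOnto Q hPQ
            (b (a (P.subtype (e (f.codRestrict N hf m)))))))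
          rw [h1, Submodule.subtype_apply, Submodule.subtype_apply,
            Submodule.projectionOnto_apply_left, LinearEquiv.symm_apply_apply]
          rfl
        rw [hgh]
        exact (hV c).of_factor (hUV c g) (hVU c h)
      · rw [Indecomposable, not_and_or] at hind
        rcases hind with hsub | hdec
        · rw [not_nontrivial_iff_subsingleton, Submodule.subsingleton_iff_eq_bot] at hsub
          have : f.restrictScalars k = 0 := by
            ext m
            have := hf m
            rw [hsub, Submodule.mem_bot] at this
            exact this
          rw [this]
          exact splits_zero U
        · push Not at hdec
          obtain ⟨P, Q, hPQ, hP, hQ⟩ := hdec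
          have hcompl : ∀ {P Q : Submodule (Hecke k q n) N}, IsCompl P Q →
              IsCompl (P.map N.subtype) (Q.map N.subtype ⊔ N') := by
            intro P Q h
            have hs : P.map N.subtype ⊔ Q.map N.subtype = N := by
              rw [← Submodule.map_sup, h.sup_eq_top, Submodule.map_top, Submodule.range_subtype]
            refine ⟨Disjoint.disjoint_sup_right_of_disjoint_sup_left ?_ ?_, ?_⟩
            · exact Submodule.disjoint_map N.subtype_injective h.disjoint
            · rw [hs]; exact hN.disjoint
            · rw [codisjoint_iff, ← sup_assoc, hs, hN.sup_eq_top]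
          have hlt : ∀ {P Q : Submodule (Hecke k q n) N}, IsCompl P Q → Q ≠ ⊥ →
              P.map N.subtype < N := by
            intro P Q h hQ
            refine lt_of_le_of_ne (Submodule.map_subtype_le N P) fun he => hQ ?_
            have : P = ⊤ := by
              apply Submodule.map_injective_of_injective N.subtype_injective
              rw [he, Submodule.map_top, Submodule.range_subtype]
            simpa [this] using h.inf_eq_bot
          let g {P Q : Submodule (Hecke k q n) N} (h : IsCompl P Q) : M →ₗ[Hecke k q n] M :=
            N.subtype ∘ₗ P.subtype ∘ₗ P.projectionOnto Q h ∘ₗ f.codRestrict N hf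
          have hg : ∀ {P Q : Submodule (Hecke k q n) N} (h : IsCompl P Q) (m : M),
              g h m ∈ P.map N.subtype :=
            fun h m => Submodule.mem_map_of_mem (Subtype.property _)
          have hsum : f.restrictScalars k =
              (g hPQ).restrictScalars k + (g hPQ.symm).restrictScalars k := by
            ext m
            have := Submodule.projection_add_projection_eq_self hPQ
              (f.codRestrict N hf m)
            exact (congrArg N.subtype this).symm
          rw [hsum]
          exact (ih _ (hlt hPQ hQ) _ (hcompl hPQ) _ (hg hPQ)).add
            (ih _ (hlt hPQ.symm hP) _ (hcompl hPQ.symm) _ (hg hPQ.symm))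
  exact key ⊤ ⊥ isCompl_top_bot LinearMap.id fun _ => Submodule.mem_top

end Decomposition

/-! ### Operators of the Hecke algebra on modules -/

section Operators

variable {k : Type*} [Field k] {q : k} {n : ℕ} {M N : Type*} [AddCommGroup M] [Module k M]
  [Module (Hecke k q n) M] [IsScalarTower k (Hecke k q n) M] [AddCommGroup N] [Module k N]
  [Module (Hecke k q n) N] [IsScalarTower k (Hecke k q n) N]

theorem ker_op_le_comap (f : M →ₗ[Hecke k q n] N) (a : Hecke k q n) :
    LinearMap.ker (op M a) ≤ (LinearMap.ker (op N a)).comap (f.restrictScalars k) := by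
  intro m hm
  change a • f m = 0
  rw [← map_smul, show a • m = 0 from hm, map_zero]

theorem range_op_le_comap (f : M →ₗ[Hecke k q n] N) (a : Hecke k q n) :
    LinearMap.range (op M a) ≤ (LinearMap.range (op N a)).comap (f.restrictScalars k) := by
  rintro _ ⟨m, rfl⟩
  exact ⟨f m, (map_smul f a m).symm⟩

variable (M)

theorem op_mul (a b : Hecke k q n) : op M (a * b) = op M a * op M b :=
  LinearMap.ext fun m => mul_smul a b m

theorem op_add (a b : Hecke k q n) : op M (a + b) = op M a + op M b :=
  LinearMap.ext fun m => add_smul a b m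

theorem op_one : op M (1 : Hecke k q n) = 1 :=
  LinearMap.ext fun m => one_smul _ m

theorem T_sq_of_zero (i : Set.Ioo 0 n) : T k (0 : k) i * T k 0 i = -T k 0 i := by
  have h := T_quad (q := (0 : k)) i
  rw [map_zero, sub_zero, mul_add, mul_one] at h
  exact eq_neg_of_add_eq_zero_left h

/-- For `q = 0` the elements `T_i + 1` act on every module as idempotents satisfying the braid
relations. -/
theorem isZeroHecke_op [Module (Hecke k (0 : k) n) M] [IsScalarTower k (Hecke k (0 : k) n) M] :
    IsZeroHecke fun i : Set.Ioo 0 n => op M (T k (0 : k) i + 1) where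
  idem i := by
    rw [← op_mul, add_mul, mul_add, mul_add, T_sq_of_zero]
    congr 1
    noncomm_ring
  braid i j h := by
    have e : ∀ a b : Hecke k (0 : k) n, a * a = -a →
        (a + 1) * (b + 1) * (a + 1) = a * b * a + a * b + b * a + a + b + 1 := fun a b ha => by
      calc (a + 1) * (b + 1) * (a + 1)
          = a * b * a + a * b + b * a + b + 1 + 2 * a + a * a := by noncomm_ring
        _ = _ := by rw [ha]; noncomm_ring
    rw [← op_mul, ← op_mul, ← op_mul, ← op_mul, e _ _ (T_sq_of_zero i), e _ _ (T_sq_of_zero j),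
      T_braid i j h]
    congr 1
    abel
  comm i j h := by
    rw [← op_mul, ← op_mul]
    congr 1
    simp only [add_mul, mul_add, mul_one, one_mul, T_comm i j h]
    abel

end Operators

end HeckeA

theorem proposition2p4 {k : Type*} [Field k] (q : k) (n : ℕ) (hn : 0 < n)
    (M : Type*) [AddCommGroup M] [Module k M] [Module (HeckeA.Hecke k q n) M]
    [IsScalarTower k (HeckeA.Hecke k q n) M] [FiniteDimensional k M]
    (hM : HeckeA.SummandsHaveOneDimSources k q n M) :
    HeckeA.KExact (fun i : Set.Ioo 0 n =>
      LinearMap.ker (HeckeA.op M (HeckeA.T k q i - algebraMap k (HeckeA.Hecke k q n) q))) ∧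
    HeckeA.KExact (fun i : Set.Ioo 0 n =>
      LinearMap.range (HeckeA.op M (HeckeA.T k q i + 1))) ∧
    HeckeA.KExact (fun i : Set.Ioo 0 n =>
      LinearMap.range (HeckeA.op M (HeckeA.T k q i - algebraMap k (HeckeA.Hecke k q n) q))) := by
  open HeckeA in
  rcases eq_or_ne q 0 with rfl | hq
  · -- `P i` is the idempotent operator of `T i + 1`, and `T i` acts as `P i - 1`.
    have hP := isZeroHecke_op (n := n) M (k := k)
    have hT : ∀ i : Set.Ioo 0 n, op M (T k (0 : k) i - algebraMap k (Hecke k 0 n) 0) =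
        op M (T k (0 : k) i + 1) - 1 := fun i => by
      rw [map_zero, sub_zero, op_add, op_one, add_sub_cancel_right]
    refine ⟨?_, ?_, ?_⟩
    · have h := hP.one_sub.splits.kExact
      convert h using 2 with i
      rw [hT, ← LinearMap.ker_neg, neg_sub]
    · have h := hP.one_sub.splits.kExact
      convert h using 2 with i
      refine range_eq_ker_of_mul (Y := 1) ?_ ?_
      · rw [sub_mul, hP.idem, one_mul, sub_self]
      · rw [sub_sub_cancel, mul_one]
    · have h := hP.splits.kExact
      convert h using 2 with i
      refine range_eq_ker_of_mul (Y := -1) ?_ ?_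
      · rw [hT, mul_sub, hP.idem, mul_one, sub_self]
      · rw [hT, mul_neg, mul_one, neg_sub]
  · refine ⟨?_, ?_, ?_⟩
    · exact (splits_of_summands hq hM (fun _ => splits_word_ker_sub)
        (fun _ f _ => ker_op_le_comap f _) (fun _ f _ => ker_op_le_comap f _)).kExact
    · exact (splits_of_summands hq hM (fun _ => splits_word_range_add)
        (fun _ f _ => range_op_le_comap f _) (fun _ f _ => range_op_le_comap f _)).kExact
    · exact (splits_of_summands hq hM (fun _ => splits_word_range_sub)
        (fun _ f _ => range_op_le_comap f _) (fun _ f _ => range_op_le_comap f _)).kExact
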